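/- Let $K$ be an algebraically closed field of characteristic zero and let $l\ge 1$ be an integer. Let $A_1^{(l)}$ be the Ore extension $K[Z,Z^{-1}][Y,\mathrm{id},\delta]$, where $\delta$ is the $K$-linear derivation with $\delta(Z)=\frac1l Z^{1-l}$. Write $X^{i/l}:=Z^i$; then $A_1^{(l)}$ has the $K$-basis $X^{i/l}Y^j$ ($i\in\mathbb Z$, $j\in\mathbb N_0$), and $[Y,X]=1$. Let $L^{(l)}=K[x^{1/l},x^{-1/l},y]$ be the corresponding commutative algebra and let $\Psi\colon A_1^{(l)}\to L^{(l)}$ be the $K$-linear bijection $X^{i/l}Y^j\mapsto x^{i/l}y^j$. For $\rho,\sigma\in\mathbb Z$ and $(a,b)\in\mathbb Q^2$ put $v_{\rho,\sigma}(a,b)=\rho a+\sigma b$. For nonzero $P\in L^{(l)}$ let $\mathrm{Supp}(P)$ be the set of points $(i/l,j)$ such that $x^{i/l}y^j$ occurs in $P$, let $v_{\rho,\sigma}(P)$ be the maximum of $v_{\rho,\sigma}$ on $\mathrm{Supp}(P)$, and let $\ell_{\rho,\sigma}(P)$ be the sum of those terms of $P$ whose exponents attain this maximum. Let $\overline w(P)$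 be the point of $\mathrm{Supp}(\ell_{-1,1}(P))$ with the largest second coordinate. For nonzero $P\in A_1^{(l)}$ put $v_{\rho,\sigma}(P)=v_{\rho,\sigma}(\Psi(P))$, $\ell_{\rho,\sigma}(P)=\ell_{\rho,\sigma}(\Psi(P))$ and $\mathrm{en}_{\rho,\sigma}(P)=\overline w(\ell_{\rho,\sigma}(P))$. Let $\mathfrak V$ be the set of pairs $(\rho,\sigma)$ of coprime integers with $\rho+\sigma>0$, and let $\mathrm{Dir}(P)$ be the set of $(\rho,\sigma)\in\mathfrak V$ such that $\ell_{\rho,\sigma}(P)$ has more than one term. Let $P,Q\in A_1^{(l)}$ and let $(\rho,\sigma)\in\mathfrak V$ with $\sigma\le 0$ be such that (a) $[Q,P]=QP-PQ=1$; (b) $(\rho,\sigma)\in\mathrm{Dir}(P)\cap\mathrm{Dir}(Q)$; (c) $v_{\rho,\sigma}(P)>0$ and $v_{\rho,\sigma}(Q)>0$; (e) $\dfrac{v_{\rho,\sigma}(Q)}{v_{\rho,\sigma}(P)}\notin\mathbb N$ and $\dfrac{v_{\rho,\sigma}(P)}{v_{\rho,\sigma}(Q)}\notin\mathbb N$. Assume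 that $\dfrac{v_{\rho,\sigma}(Q)}{v_{\rho,\sigma}(P)}=\dfrac nm$ with $n,m>1$ coprime integers. Then $$\frac1m\,\mathrm{en}_{\rho,\sigma}(P)\neq\left(\bar r-\frac1l,\ \bar r\right)\qquad\text{for every rational number } \bar r\ge 2 .$$ -/

import Mathlib

noncomputable section

/-! ### Ore extensions `A[Y, id, δ]` of a commutative algebra by a derivation -/

namespace Ore

open Polynomial

variable {K A : Type*} [CommRing K] [CommRing A] [Algebra K A]

/-- Left multiplication by `Y` on `⨁ A Y ^ j`, that is
`Y * (b Y ^ j) = b Y ^ (j + 1) + δ b Y ^ j`. -/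
def leftY (δ : Derivation K A A) : A[X] →ₗ[K] A[X] :=
  lsum fun j => (monomial (j + 1)).restrictScalars K +
    ((monomial j).restrictScalars K).comp (δ : A →ₗ[K] A)

/-- Left multiplication by `∑ a_i Y ^ i`, that is `q ↦ ∑ a_i (Y * (Y * ⋯ (Y * q)))`. -/
def leftMul (δ : Derivation K A A) : A[X] →ₗ[K] Module.End K A[X] :=
  lsum fun i => (LinearMap.mulRight K ((leftY δ) ^ i)).comp
    ((LinearMap.mul K A[X]).comp (monomial 0 |>.restrictScalars K))

theorem leftY_monomial (δ : Derivation K A A) (j : ℕ) (b : A) :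
    leftY δ (monomial j b) = monomial (j + 1) b + monomial j (δ b) := by
  simp [leftY]

theorem leftMul_monomial (δ : Derivation K A A) (i : ℕ) (a : A) (q : A[X]) :
    leftMul δ (monomial i a) q = C a * ((leftY δ) ^ i) q := by
  simp [leftMul]

theorem leftY_C_mul (δ : Derivation K A A) (a : A) (q : A[X]) :
    leftY δ (C a * q) = C a * leftY δ q + C (δ a) * q := by
  induction q using Polynomial.induction_on' with
  | add p q hp hq => simp only [mul_add, map_add, hp, hq]; ring
  | monomial j b =>
    simp only [leftY_monomial, C_mul_monomial, mul_add, Derivation.leibniz, smul_eq_mul, map_add]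
    rw [mul_comm b (δ a)]
    ring

theorem leftMul_C_mul (δ : Derivation K A A) (a : A) (q r : A[X]) :
    leftMul δ (C a * q) r = C a * leftMul δ q r := by
  induction q using Polynomial.induction_on' with
  | add p q hp hq => simp only [mul_add, map_add, LinearMap.add_apply, hp, hq]
  | monomial j b => simp only [C_mul_monomial, leftMul_monomial, map_mul, mul_assoc]

theorem leftMul_leftY (δ : Derivation K A A) (q r : A[X]) :
    leftMul δ (leftY δ q) r = leftY δ (leftMul δ q r) := by
  induction q using Polynomial.induction_on' with
  | add p q hp hq => simp only [map_add, LinearMap.add_apply, hp, hq]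
  | monomial j b =>
    simp only [leftY_monomial, map_add, LinearMap.add_apply, leftMul_monomial, leftY_C_mul,
      pow_succ', Module.End.mul_apply]

theorem leftMul_leftMul (δ : Derivation K A A) (p q r : A[X]) :
    leftMul δ (leftMul δ p q) r = leftMul δ p (leftMul δ q r) := by
  induction p using Polynomial.induction_on' with
  | add p p' hp hp' => simp only [map_add, LinearMap.add_apply, hp, hp']
  | monomial i a =>
    simp only [leftMul_monomial, leftMul_C_mul]
    congr 1
    induction i with
    | zero => simp
    | succ i ih => simp only [pow_succ', Module.End.mul_apply, leftMul_leftY, ih]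

theorem leftY_pow_one (δ : Derivation K A A) (i : ℕ) :
    ((leftY δ) ^ i) (1 : A[X]) = X ^ i := by
  induction i with
  | zero => simp
  | succ i ih =>
    rw [pow_succ', Module.End.mul_apply, ih, X_pow_eq_monomial, leftY_monomial]
    simp [X_pow_eq_monomial]

theorem leftMul_one_right (δ : Derivation K A A) (p : A[X]) : leftMul δ p 1 = p := by
  induction p using Polynomial.induction_on' with
  | add p q hp hq => simp only [map_add, LinearMap.add_apply, hp, hq]
  | monomial i a => rw [leftMul_monomial, leftY_pow_one, C_mul_X_pow_eq_monomial]

end Ore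

/-- The Ore extension `A[Y, id, δ]`: as a left `A`-module it is free with basis the powers of `Y`,
so its elements are the sums `∑ a_j Y ^ j`, stored as the polynomial with coefficients `a_j`;
the product is determined by `Y * a = a * Y + δ a`. -/
def OreExtension {K A : Type*} [CommRing K] [CommRing A] [Algebra K A]
    (_δ : Derivation K A A) : Type _ := Polynomial A

namespace OreExtension

variable {K A : Type*} [CommRing K] [CommRing A] [Algebra K A]

instance (δ : Derivation K A A) : AddCommGroup (OreExtension δ) :=
  inferInstanceAs (AddCommGroup (Polynomial A))

instance (δ : Derivation K A A) : Module K (OreExtension δ) :=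
  inferInstanceAs (Module K (Polynomial A))

/-- The `K`-linear bijection `∑ a_j Y ^ j ↦ ∑ a_j y ^ j` onto the commutative polynomial ring. -/
def toPoly (δ : Derivation K A A) : OreExtension δ ≃ₗ[K] Polynomial A :=
  LinearEquiv.refl K (Polynomial A)

instance (δ : Derivation K A A) : Ring (OreExtension δ) :=
  { (inferInstance : AddCommGroup (OreExtension δ)) with
    mul := fun p q => (toPoly δ).symm (Ore.leftMul δ (toPoly δ p) (toPoly δ q))
    one := (toPoly δ).symm 1
    left_distrib := fun p q r => (Ore.leftMul δ (toPoly δ p)).map_add (toPoly δ q) (toPoly δ r)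
    right_distrib := fun p q r => by
      change Ore.leftMul δ (toPoly δ p + toPoly δ q) (toPoly δ r) =
        Ore.leftMul δ (toPoly δ p) (toPoly δ r) + Ore.leftMul δ (toPoly δ q) (toPoly δ r)
      rw [map_add, LinearMap.add_apply]
    zero_mul := fun p => by
      change Ore.leftMul δ 0 (toPoly δ p) = 0
      rw [map_zero, LinearMap.zero_apply]
    mul_zero := fun p => (Ore.leftMul δ (toPoly δ p)).map_zero
    mul_assoc := fun p q r => Ore.leftMul_leftMul δ (toPoly δ p) (toPoly δ q) (toPoly δ r)
    one_mul := fun p => by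
      change Ore.leftMul δ (Polynomial.monomial 0 1) (toPoly δ p) = toPoly δ p
      rw [Ore.leftMul_monomial]
      simp
    mul_one := fun p => Ore.leftMul_one_right δ (toPoly δ p) }

/-- The element `Y`. -/
def Y (δ : Derivation K A A) : OreExtension δ := (toPoly δ).symm Polynomial.X

/-- The inclusion `A → A[Y, id, δ]`. -/
def C (δ : Derivation K A A) (a : A) : OreExtension δ := (toPoly δ).symm (Polynomial.C a)

theorem toPoly_mul (δ : Derivation K A A) (p q : OreExtension δ) :
    toPoly δ (p * q) = Ore.leftMul δ (toPoly δ p) (toPoly δ q) := rfl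

/-- The defining relation of the Ore extension. -/
theorem Y_mul_C (δ : Derivation K A A) (a : A) : Y δ * C δ a = C δ a * Y δ + C δ (δ a) := by
  apply (toPoly δ).injective
  rw [map_add, toPoly_mul, toPoly_mul]
  simp only [Y, C, LinearEquiv.apply_symm_apply]
  rw [← Polynomial.monomial_one_one_eq_X, ← Polynomial.monomial_zero_left,
    Ore.leftMul_monomial, Ore.leftMul_monomial]
  simp only [Ore.leftY_monomial, pow_one, pow_zero, Module.End.one_apply, map_one, one_mul,
    Polynomial.C_mul_monomial, mul_one, zero_add]
  rw [Polynomial.monomial_zero_left]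

end OreExtension

/-! ### The algebras `A_1^{(l)}` and `L^{(l)}` -/

open LaurentPolynomial in
/-- The linear map `Z ^ i ↦ (i / l) Z ^ (i - l)` on Laurent polynomials in `Z = Z_l = X ^ (1 / l)`,
that is `X ^ (i / l) ↦ (i / l) X ^ (i / l - 1)`. -/
def fracDerivLinear (K : Type*) [Field K] (l : ℕ) :
    LaurentPolynomial K →ₗ[K] LaurentPolynomial K :=
  (Finsupp.lsum K fun i : ℤ =>
    ((i : K) / (l : K)) • (AddMonoidAlgebra.lsingle (i - l) : K →ₗ[K] LaurentPolynomial K)).comp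
    (AddMonoidAlgebra.coeffLinearEquiv K).toLinearMap

theorem fracDerivLinear_single (K : Type*) [Field K] (l : ℕ) (i : ℤ) (c : K) :
    fracDerivLinear K l (AddMonoidAlgebra.single i c) =
      AddMonoidAlgebra.single (i - l) ((i : K) / (l : K) * c) := by
  change (Finsupp.lsum K fun i : ℤ => ((i : K) / (l : K)) •
    (AddMonoidAlgebra.lsingle (i - l) : K →ₗ[K] LaurentPolynomial K)) (Finsupp.single i c) = _
  rw [Finsupp.lsum_single, LinearMap.smul_apply]
  change ((i : K) / (l : K)) • AddMonoidAlgebra.single (i - (l : ℤ)) c = _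
  rw [AddMonoidAlgebra.smul_single, smul_eq_mul]

/-- The derivation `δ` of `K[Z, Z⁻¹]` with `δ Z = (1 / l) Z ^ (1 - l)`. -/
def fracDeriv (K : Type*) [Field K] (l : ℕ) :
    Derivation K (LaurentPolynomial K) (LaurentPolynomial K) :=
  Derivation.mk' (fracDerivLinear K l) (by
    intro a b
    induction a using AddMonoidAlgebra.induction_linear with
    | zero => simp
    | add f g hf hg => simp only [add_mul, map_add, hf, hg, smul_eq_mul, mul_add]; ring
    | single i c =>
      induction b using AddMonoidAlgebra.induction_linear with
      | zero => simp
      | add f g hf hg => simp only [add_mul, map_add, hf, hg, smul_eq_mul, mul_add]; ring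
      | single j d =>
        simp only [smul_eq_mul, fracDerivLinear_single, AddMonoidAlgebra.single_mul_single]
        rw [show i + (j - (l : ℤ)) = i + j - l by ring, show j + (i - (l : ℤ)) = i + j - l by ring,
          ← AddMonoidAlgebra.single_add]
        congr 1
        push_cast
        ring)

theorem fracDeriv_T (K : Type*) [Field K] (l : ℕ) :
    fracDeriv K l (LaurentPolynomial.T 1) =
      LaurentPolynomial.C (1 / (l : K)) * LaurentPolynomial.T (1 - (l : ℤ)) := by
  rw [← LaurentPolynomial.single_eq_C_mul_T]
  change fracDerivLinear K l (AddMonoidAlgebra.single 1 1) = _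
  rw [fracDerivLinear_single]
  simp

/-- The algebra `A_1^{(l)} = K[Z, Z⁻¹][Y, id, δ]`, where `Z = X ^ (1 / l)`. -/
abbrev WeylFrac (K : Type*) [Field K] (l : ℕ) : Type _ := OreExtension (fracDeriv K l)

/-- The commutative algebra `L^{(l)} = K[x ^ (1 / l), x ^ (-1 / l), y]`; the variable of the
Laurent polynomials is `x ^ (1 / l)` and the polynomial variable is `y`. -/
abbrev LFrac (K : Type*) [Field K] : Type _ := Polynomial (LaurentPolynomial K)

/-- The `K`-linear bijection `Ψ : A_1^{(l)} → L^{(l)}`, `X ^ (i / l) Y ^ j ↦ x ^ (i / l) y ^ j`. -/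
def Psi (K : Type*) [Field K] (l : ℕ) : WeylFrac K l ≃ₗ[K] LFrac K :=
  OreExtension.toPoly (fracDeriv K l)

/-! ### Directions, degrees, leading terms and end points -/

/-- The set `𝔙` of directions. -/
def Directions : Set (ℤ × ℤ) := {d | Int.gcd d.1 d.2 = 1 ∧ 0 < d.1 + d.2}

/-- `v_{ρ,σ}(a, b) = ρ a + σ b`. -/
def vPoint (d : ℤ × ℤ) (p : ℚ × ℚ) : ℚ := d.1 * p.1 + d.2 * p.2

/-- The maximum of `f` over a finite set (`0` if the set is empty). -/
def maxOver {α : Type*} (s : Finset α) (f : α → ℚ) : ℚ :=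
  if h : s.Nonempty then s.sup' h f else 0

namespace LFrac

variable {K : Type*} [Field K]

/-- The set of `(i, j)` such that `x ^ (i / l) y ^ j` occurs in `P`. -/
def expSupport (P : LFrac K) : Finset (ℤ × ℕ) :=
  P.support.biUnion fun j => (P.coeff j).coeff.support.image fun i => (i, j)

/-- The point `(i / l, j)`. -/
def point (l : ℕ) (e : ℤ × ℕ) : ℚ × ℚ := ((e.1 : ℚ) / (l : ℚ), (e.2 : ℚ))

/-- The support of `P`, the set of the points `(i / l, j)` such that `x ^ (i / l) y ^ j` occurs
in `P`. -/
def supp (l : ℕ) (P : LFrac K) : Finset (ℚ × ℚ) := (expSupport P).image (point l)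

/-- The degree `v_{ρ,σ}(P)` of `P ≠ 0` (by convention `0` if `P = 0`). -/
def vDeg (l : ℕ) (d : ℤ × ℤ) (P : LFrac K) : ℚ := maxOver (supp l P) (vPoint d)

/-- The leading term `ℓ_{ρ,σ}(P)`. -/
def lead (l : ℕ) (d : ℤ × ℤ) (P : LFrac K) : LFrac K :=
  ∑ e ∈ (expSupport P).filter (fun e => vPoint d (point l e) = vDeg l d P),
    Polynomial.monomial e.2 (AddMonoidAlgebra.single e.1 ((P.coeff e.2).coeff e.1))

/-- `w̄(P) = (t - v_{-1,1}(P), t)`, where `t` is the largest second coordinate of a point in the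
support of `ℓ_{-1,1}(P)`. -/
def wBar (l : ℕ) (P : LFrac K) : ℚ × ℚ :=
  (maxOver (supp l (lead l (-1, 1) P)) Prod.snd - vDeg l (-1, 1) P,
    maxOver (supp l (lead l (-1, 1) P)) Prod.snd)

end LFrac

namespace WeylFrac

variable {K : Type*} [Field K] {l : ℕ}

/-- The degree `v_{ρ,σ}(P)`. -/
def vDeg (d : ℤ × ℤ) (P : WeylFrac K l) : ℚ := LFrac.vDeg l d (Psi K l P)

/-- The leading term `ℓ_{ρ,σ}(P)`. -/
def lead (d : ℤ × ℤ) (P : WeylFrac K l) : LFrac K := LFrac.lead l d (Psi K l P)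

/-- The end point `en_{ρ,σ}(P) = w̄(ℓ_{ρ,σ}(P))`. -/
def en (d : ℤ × ℤ) (P : WeylFrac K l) : ℚ × ℚ := LFrac.wBar l (lead d P)

/-- The directions associated with `P`: those whose leading term has at least two monomials. -/
def Dir (P : WeylFrac K l) : Set (ℤ × ℤ) :=
  {d | d ∈ Directions ∧ 1 < (LFrac.supp l (lead d P)).card}

end WeylFrac

end

/-! Put τ = σ/ρ > -1 and give x^(i/l) y^j the weight i/l + τ j. A leading form of weight c is x^c
times a polynomial in z = x^(-τ) y. If leading forms of weights a, b correspond to polynomials p, q,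
then in weight a + b - (1 + τ) the commutator has the polynomial b p' q - a p q' (`sym_commutator`).
So [Q, P] = 1 forces a weighted Wronskian of the two leading polynomials to be constant.

Suppose the end point of P is m (r - 1/l, r). Comparing degrees in the Wronskian shows that r is an
integer and that the end point of Q is n (r - 1/l, r). The exponents lie in (1/l)ℤ × ℕ, and for
these corners this forces the Wronskian to vanish (`brk_eq_zero_of_isCorner`). Hence n times each
root multiplicity of p is m times that of q, and p is, up to a constant, an m-th power g^m.

The second ingredient is a polynomial f with a f' p - (1 + τ) f p' = p (`exists_normalizer`). A
dimension count shows that some element of the algebra generated by P and Q has a leading form not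
in involution with that of P; f is obtained from such an element of least degree in Q. After
subtracting a multiple of a power of g if necessary, f has degree 1. The equation is then of Euler
type and p has a single root α; so has q, with the same α (`exists_sym_eq_pow`).

The automorphism Y ↦ Y + α X^τ moves this root to 0, so that both faces shrink to their end points.
Now τ can be decreased until a new face appears, with the same two corners, and the argument
repeats. A shift with α ≠ 0 is possible only if l τ is an integer, so finitely many turns lead to τ
= -1. There P and Q have the negative weights -m/l and -n/l, while their bracket 1 has weight 0: a
contradiction (`false_of_isCorner_neg_one`). -/

noncomputable section

/-! ### Weight filtration and leading forms as polynomials in one variable. -/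

namespace LFrac

open Polynomial

variable {K : Type*} [Field K]

/-- The weight `i / l + τ j` of the monomial `x ^ (i / l) y ^ j`. -/
def wt (l : ℕ) (τ : ℚ) (i : ℤ) (j : ℕ) : ℚ := i / l + τ * j

/-- The monomial `a x ^ (i / l) y ^ j`. -/
def mon (i : ℤ) (j : ℕ) (a : K) : LFrac K :=
  Polynomial.monomial j (AddMonoidAlgebra.single i a)

theorem coeff_mon (i i' : ℤ) (j j' : ℕ) (a : K) :
    ((mon i j a).coeff j').coeff i' = if j = j' ∧ i = i' then a else 0 := by
  rw [mon, Polynomial.coeff_monomial]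
  by_cases hj : j = j'
  · by_cases hi : i = i' <;>
      simp [hj, hi, AddMonoidAlgebra.coeff_single, -LaurentPolynomial.single_eq_C_mul_T]
  · simp [hj]

/-- The elements all of whose monomials have weight at most `c`. -/
def fil (l : ℕ) (τ c : ℚ) : Submodule K (LFrac K) where
  carrier := {P | ∀ i j, (P.coeff j).coeff i ≠ 0 → wt l τ i j ≤ c}
  zero_mem' := by intro i j h; simp at h
  add_mem' := by
    intro P Q hP hQ i j h
    by_cases h1 : (P.coeff j).coeff i = 0
    · apply hQ
      intro h2
      apply h
      simp [h1, h2]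
    · exact hP i j h1
  smul_mem' := by
    intro a P hP i j h
    apply hP
    intro h1
    apply h
    simp [h1]

theorem fil_mono {l : ℕ} {τ c c' : ℚ} (h : c ≤ c') : fil (K := K) l τ c ≤ fil l τ c' :=
  fun _ hP i j hij => (hP i j hij).trans h

theorem mon_mem_fil {l : ℕ} {τ c : ℚ} {i : ℤ} {j : ℕ} (a : K) (h : wt l τ i j ≤ c) :
    mon i j a ∈ fil l τ c := by
  intro i' j' h'
  rw [coeff_mon] at h'
  by_cases hc : j = j' ∧ i = i'
  · rw [← hc.1, ← hc.2]; exact h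
  · simp [hc] at h'

theorem eq_sum_mon (P : LFrac K) :
    P = ∑ j ∈ P.support, ∑ i ∈ (P.coeff j).coeff.support, mon i j ((P.coeff j).coeff i) := by
  conv_lhs => rw [P.as_sum_support]
  refine Finset.sum_congr rfl fun j _ => ?_
  simp only [mon]
  rw [← map_sum]
  congr 1
  exact (AddMonoidAlgebra.sum_coeff_single (P.coeff j)).symm

theorem fil_induction {l : ℕ} {τ c : ℚ} {p : LFrac K → Prop} (h0 : p 0)
    (hadd : ∀ P Q, p P → p Q → p (P + Q))
    (hmon : ∀ i j a, wt l τ i j ≤ c → p (mon i j a)) {P : LFrac K} (hP : P ∈ fil l τ c) : p P := by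
  rw [eq_sum_mon P]
  refine Finset.sum_induction _ p hadd h0 fun j _ => ?_
  refine Finset.sum_induction _ p hadd h0 fun i hi => ?_
  exact hmon _ _ _ (hP i j (by simpa using hi))

/-- The part of weight `c` of an element of `L^{(l)}`, as a polynomial in `z = x ^ (-τ) y`. -/
def sym (l : ℕ) (τ c : ℚ) : LFrac K →ₗ[K] K[X] :=
  lsum fun j => (Polynomial.monomial j).comp
    ((Finsupp.lsum K fun i : ℤ => if wt l τ i j = c then (LinearMap.id : K →ₗ[K] K) else 0).comp
      (AddMonoidAlgebra.coeffLinearEquiv K).toLinearMap)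

theorem sym_mon (l : ℕ) (τ c : ℚ) (i : ℤ) (j : ℕ) (a : K) :
    sym l τ c (mon i j a) = if wt l τ i j = c then Polynomial.monomial j a else 0 := by
  have : sym l τ c (mon i j a) = Polynomial.monomial j
      ((Finsupp.lsum K fun i : ℤ => if wt l τ i j = c then (LinearMap.id : K →ₗ[K] K) else 0)
        (Finsupp.single i a)) := by
    simp only [sym, mon, lsum_apply]
    rw [Polynomial.sum_monomial_index _ _ (by simp)]
    rfl
  rw [this, Finsupp.lsum_single]
  split_ifs <;> simp

theorem wt_injective {l : ℕ} (hl : 0 < l) {τ : ℚ} {i i' : ℤ} {j : ℕ}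
    (h : wt l τ i j = wt l τ i' j) : i = i' := by
  have hl' : (l : ℚ) ≠ 0 := by exact_mod_cast hl.ne'
  simp only [wt, add_left_inj] at h
  field_simp at h
  exact_mod_cast h

/-- For fixed j the weight determines i, so distinct monomials of one weight never collide in `sym`.
-/
theorem sym_coeff {l : ℕ} (hl : 0 < l) (τ : ℚ) (i : ℤ) (j : ℕ) (P : LFrac K) :
    (sym l τ (wt l τ i j) P).coeff j = (P.coeff j).coeff i := by
  conv_lhs => rw [eq_sum_mon P]
  conv_rhs => rw [eq_sum_mon P]
  simp only [map_sum, finsetSum_coeff, AddMonoidAlgebra.coeff_sum, Finsupp.coe_finsetSum,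
    Finset.sum_apply, coeff_mon, sym_mon]
  refine Finset.sum_congr rfl fun j' _ => Finset.sum_congr rfl fun i' _ => ?_
  by_cases hj : j' = j
  · subst hj
    by_cases hi : i' = i
    · simp [hi]
    · have : ¬ wt l τ i' j' = wt l τ i j' := fun h => hi (wt_injective hl h)
      simp [hi, this]
  · split_ifs <;> simp_all [Polynomial.coeff_monomial]

theorem exists_of_sym_coeff_ne_zero {l : ℕ} {τ c : ℚ} {j : ℕ} {P : LFrac K}
    (h : (sym l τ c P).coeff j ≠ 0) : ∃ i, wt l τ i j = c := by
  by_contra! hne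
  apply h
  rw [eq_sum_mon P]
  simp only [map_sum, finsetSum_coeff, sym_mon]
  refine Finset.sum_eq_zero fun j' _ => Finset.sum_eq_zero fun i' _ => ?_
  split_ifs with hw
  · rw [Polynomial.coeff_monomial, if_neg]
    rintro rfl
    exact hne _ hw
  · simp

theorem sym_eq_zero_of_mem_fil {l : ℕ} {τ c c' : ℚ} {P : LFrac K} (hP : P ∈ fil l τ c')
    (h : c' < c) : sym l τ c P = 0 := by
  refine fil_induction (p := fun P => sym l τ c P = 0) (map_zero _) ?_ ?_ hP
  · intro P Q hP hQ
    rw [map_add, hP, hQ, add_zero]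
  · intro i j a hw
    rw [sym_mon, if_neg (hw.trans_lt h).ne]

theorem exists_sym_ne_zero {l : ℕ} (hl : 0 < l) (τ : ℚ) {P : LFrac K} (hP : P ≠ 0) :
    ∃ c, P ∈ fil l τ c ∧ sym l τ c P ≠ 0 := by
  have hne : (expSupport P).Nonempty := by
    obtain ⟨j, hj⟩ := Polynomial.support_nonempty.2 hP
    have : (P.coeff j).coeff ≠ 0 := fun h => Polynomial.mem_support_iff.1 hj (by ext i; simp [h])
    obtain ⟨i, hi⟩ := Finsupp.support_nonempty_iff.2 this
    exact ⟨(i, j), Finset.mem_biUnion.2 ⟨j, hj, Finset.mem_image.2 ⟨i, hi, rfl⟩⟩⟩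
  obtain ⟨⟨i, j⟩, he, hmax⟩ := (expSupport P).exists_max_image (fun e => wt l τ e.1 e.2) hne
  have hmem : ∀ i j, (i, j) ∈ expSupport P ↔ (P.coeff j).coeff i ≠ 0 := by
    intro i j
    simp only [expSupport, Finset.mem_biUnion, Finset.mem_image, Finsupp.mem_support_iff,
      Prod.mk.injEq, Polynomial.mem_support_iff]
    constructor
    · rintro ⟨j, _, i, hi, rfl, rfl⟩; exact hi
    · intro h
      exact ⟨j, fun h0 => h (by simp [h0]), i, h, rfl, rfl⟩
  refine ⟨wt l τ i j, fun i' j' h => hmax (i', j') ((hmem _ _).2 h), fun h => ?_⟩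
  apply (hmem i j).1 he
  rw [← sym_coeff hl τ, h, Polynomial.coeff_zero]

end LFrac

end

/-! ### Products and commutators with respect to the filtration. -/

noncomputable section

namespace LFrac

open Polynomial

variable {K : Type*} [Field K]

theorem mon_zero (i : ℤ) (j : ℕ) : mon i j (0 : K) = 0 := by simp [mon]

theorem mon_add (i : ℤ) (j : ℕ) (a b : K) : mon i j (a + b) = mon i j a + mon i j b := by
  simp only [mon, AddMonoidAlgebra.single_add, map_add]

theorem C_single_mul_mon (i i' : ℤ) (j : ℕ) (a b : K) :
    Polynomial.C (AddMonoidAlgebra.single i a) * mon i' j b = mon (i + i') j (a * b) := by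
  rw [mon, mon, Polynomial.C_mul_monomial, AddMonoidAlgebra.single_mul_single]

theorem leftY_mon (l : ℕ) (i : ℤ) (j : ℕ) (b : K) :
    Ore.leftY (fracDeriv K l) (mon i j b) = mon i (j + 1) b + mon (i - l) j ((i : K) / l * b) := by
  rw [mon, Ore.leftY_monomial]
  change _ + Polynomial.monomial j (fracDerivLinear K l _) = _
  rw [fracDerivLinear_single]
  rfl

theorem wt_sub {l : ℕ} (hl : 0 < l) (τ : ℚ) (i : ℤ) (j : ℕ) :
    wt l τ (i - l) j = wt l τ i j - 1 := by
  have hl' : (l : ℚ) ≠ 0 := by exact_mod_cast hl.ne'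
  simp only [wt]; push_cast; field_simp; ring

theorem wt_succ (l : ℕ) (τ : ℚ) (i : ℤ) (j : ℕ) : wt l τ i (j + 1) = wt l τ i j + τ := by
  simp only [wt]; push_cast; ring

theorem wt_add (l : ℕ) (τ : ℚ) (i i' : ℤ) (j j' : ℕ) :
    wt l τ (i + i') (j + j') = wt l τ i j + wt l τ i' j' := by
  simp only [wt]; push_cast; ring

/-- Differentiating the coefficient changes the weight by -1, which stays within the allowed change
τ exactly when -1 ≤ τ. -/
theorem leftY_mem_fil {l : ℕ} (hl : 0 < l) {τ c : ℚ} (hτ : -1 ≤ τ) {P : LFrac K}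
    (hP : P ∈ fil l τ c) : Ore.leftY (fracDeriv K l) P ∈ fil l τ (c + τ) := by
  refine fil_induction (p := fun P => Ore.leftY (fracDeriv K l) P ∈ fil l τ (c + τ)) ?_ ?_ ?_ hP
  · rw [map_zero]; exact zero_mem _
  · intro P Q hP hQ
    rw [map_add]; exact add_mem hP hQ
  · intro i j a h
    rw [leftY_mon]
    refine add_mem (mon_mem_fil _ ?_) (mon_mem_fil _ ?_)
    · rw [wt_succ]; linarith
    · rw [wt_sub hl]; linarith

theorem C_single_mul_mem_fil {l : ℕ} {τ c : ℚ} (i : ℤ) (a : K) {P : LFrac K}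
    (hP : P ∈ fil l τ c) :
    Polynomial.C (AddMonoidAlgebra.single i a) * P ∈ fil l τ (i / l + c) := by
  refine fil_induction (p := fun P => Polynomial.C (AddMonoidAlgebra.single i a) * P ∈
    fil l τ (i / l + c)) ?_ ?_ ?_ hP
  · rw [mul_zero]; exact zero_mem _
  · intro P Q hP hQ
    rw [mul_add]; exact add_mem hP hQ
  · intro i' j a h
    rw [C_single_mul_mon]
    refine mon_mem_fil _ ?_
    simp only [wt] at h ⊢
    push_cast
    rw [add_div]
    linarith

/-- Each use of Y a = a Y + δ(a) that differentiates costs 1 + τ in weight. The term with one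
differentiation is kept because it carries the leading form of a commutator. For k = 0 the truncated
exponent is harmless, since its coefficient vanishes. -/
theorem leftY_pow_mon {l : ℕ} (hl : 0 < l) {τ : ℚ} (hτ : -1 ≤ τ) (i : ℤ) (j k : ℕ) (b : K) :
    (Ore.leftY (fracDeriv K l) ^ k) (mon i j b) - mon i (k + j) b
      - mon (i - l) (k + j - 1) (k * ((i : K) / l) * b) ∈
      fil l τ (wt l τ i j + k * τ - 2 * (1 + τ)) := by
  induction k with
  | zero => simp [mon_zero]
  | succ k ih =>
    have h1 := leftY_mem_fil hl hτ ih
    rw [map_sub, map_sub, leftY_mon, leftY_mon] at h1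
    have e : wt l τ i j + k * τ - 2 * (1 + τ) + τ = wt l τ i j + (k + 1 : ℕ) * τ - 2 * (1 + τ) := by
      push_cast; ring
    rw [e] at h1
    rw [pow_succ', Module.End.mul_apply]
    have h2 : mon (i - l - l) (k + j - 1) (((i - l : ℤ) : K) / l * (k * ((i : K) / l) * b)) ∈
        fil l τ (wt l τ i j + (k + 1 : ℕ) * τ - 2 * (1 + τ)) := by
      rcases Nat.eq_zero_or_pos k with rfl | hk
      · simp [mon_zero]
      · refine mon_mem_fil _ ?_
        rw [wt_sub hl, wt_sub hl]
        obtain ⟨k, rfl⟩ := Nat.exists_eq_add_of_le' hk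
        rw [show k + 1 + j - 1 = k + j by omega]
        simp only [wt]; push_cast; linarith
    have h3 : mon (i - l) (k + j - 1 + 1) (k * ((i : K) / l) * b) =
        mon (i - l) (k + j) (k * ((i : K) / l) * b) := by
      rcases Nat.eq_zero_or_pos k with rfl | hk
      · simp [mon_zero]
      · rw [show k + j - 1 + 1 = k + j by omega]
    rw [h3] at h1
    have h4 := add_mem h1 h2
    convert h4 using 1
    rw [show k + 1 + j = k + j + 1 by omega, Nat.add_sub_cancel,
      show ((k + 1 : ℕ) : K) * ((i : K) / l) * b = k * ((i : K) / l) * b + (i : K) / l * b by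
        push_cast; ring, mon_add]
    abel

theorem leftMul_mon_mon {l : ℕ} (hl : 0 < l) {τ : ℚ} (hτ : -1 ≤ τ) (i i' : ℤ) (j j' : ℕ) (a b : K) :
    Ore.leftMul (fracDeriv K l) (mon i j a) (mon i' j' b) - mon (i + i') (j + j') (a * b)
      - mon (i + i' - l) (j + j' - 1) (j * ((i' : K) / l) * (a * b)) ∈
      fil l τ (wt l τ i j + wt l τ i' j' - 2 * (1 + τ)) := by
  have h := C_single_mul_mem_fil i a (leftY_pow_mon hl hτ i' j' j b)
  rw [mul_sub, mul_sub, C_single_mul_mon, C_single_mul_mon, add_comm j j'] at h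
  rw [show mon i j a = Polynomial.monomial j (AddMonoidAlgebra.single i a) from rfl,
    Ore.leftMul_monomial, add_comm j j']
  have e : (i : ℚ) / l + (wt l τ i' j' + j * τ - 2 * (1 + τ)) =
      wt l τ i j + wt l τ i' j' - 2 * (1 + τ) := by simp only [wt]; ring
  rw [e] at h
  rw [show i + (i' - (l : ℤ)) = i + i' - l by ring, add_comm j' j,
    show a * (j * ((i' : K) / l) * b) = j * ((i' : K) / l) * (a * b) by ring] at h
  rw [add_comm j' j]
  exact h

theorem correction_mem_fil {l : ℕ} (hl : 0 < l) {τ : ℚ} (i i' : ℤ) (j j' : ℕ) (x : K) :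
    mon (i + i' - l) (j + j' - 1) (j * x) ∈
      fil l τ (wt l τ i j + wt l τ i' j' - (1 + τ)) := by
  rcases Nat.eq_zero_or_pos j with rfl | hj
  · simp [mon_zero]
  · refine mon_mem_fil _ ?_
    obtain ⟨j, rfl⟩ := Nat.exists_eq_add_of_le' hj
    rw [show j + 1 + j' - 1 = j + j' by omega, wt_sub hl]
    simp only [wt]; push_cast; rw [add_div]; linarith

theorem leftMul_mon_mon_sub_mem_fil {l : ℕ} (hl : 0 < l) {τ : ℚ} (hτ : -1 ≤ τ) (i i' : ℤ)
    (j j' : ℕ) (a b : K) :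
    Ore.leftMul (fracDeriv K l) (mon i j a) (mon i' j' b) - mon (i + i') (j + j') (a * b) ∈
      fil l τ (wt l τ i j + wt l τ i' j' - (1 + τ)) := by
  have h := add_mem (fil_mono (by linarith) (leftMul_mon_mon hl hτ i i' j j' a b))
    (correction_mem_fil hl (τ := τ) i i' j j' ((i' : K) / l * (a * b)))
  convert h using 1
  rw [mul_assoc]
  abel

/-- Two-variable induction on the elements of bounded weight. -/
theorem fil_induction₂ {l : ℕ} {τ c c' : ℚ} {p : LFrac K → LFrac K → Prop}
    (h0l : ∀ Q, p 0 Q) (h0r : ∀ P, p P 0)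
    (haddl : ∀ P P' Q, p P Q → p P' Q → p (P + P') Q)
    (haddr : ∀ P Q Q', p P Q → p P Q' → p P (Q + Q'))
    (hmon : ∀ i j a i' j' b, wt l τ i j ≤ c → wt l τ i' j' ≤ c' → p (mon i j a) (mon i' j' b))
    {P Q : LFrac K} (hP : P ∈ fil l τ c) (hQ : Q ∈ fil l τ c') : p P Q := by
  refine fil_induction (p := fun P => p P Q) (h0l _) (fun _ _ => haddl _ _ _) ?_ hP
  intro i j a hw
  exact fil_induction (p := fun Q => p (mon i j a) Q) (h0r _) (fun _ _ => haddr _ _ _)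
    (fun i' j' b hw' => hmon i j a i' j' b hw hw') hQ

theorem leftMul_mem_fil {l : ℕ} (hl : 0 < l) {τ c c' : ℚ} (hτ : -1 ≤ τ) {P Q : LFrac K}
    (hP : P ∈ fil l τ c) (hQ : Q ∈ fil l τ c') :
    Ore.leftMul (fracDeriv K l) P Q ∈ fil l τ (c + c') := by
  refine fil_induction₂ (p := fun P Q => Ore.leftMul (fracDeriv K l) P Q ∈ fil l τ (c + c'))
    ?_ ?_ ?_ ?_ ?_ hP hQ
  · intro Q; rw [map_zero]; exact zero_mem _
  · intro P; rw [map_zero]; exact zero_mem _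
  · intro P P' Q h h'; rw [map_add]; exact add_mem h h'
  · intro P Q Q' h h'; rw [map_add]; exact add_mem h h'
  · intro i j a i' j' b h h'
    have h1 := leftMul_mon_mon_sub_mem_fil hl hτ i i' j j' a b
    rw [← sub_add_cancel (Ore.leftMul (fracDeriv K l) (mon i j a) (mon i' j' b))
      (mon (i + i') (j + j') (a * b))]
    refine add_mem (fil_mono ?_ h1) (mon_mem_fil _ ?_)
    · linarith
    · rw [wt_add]; linarith

/-- The noncommutative corrections have weight lower by at least 1 + τ, so the strict inequality -1
< τ makes them invisible in top weight. -/
theorem sym_leftMul {l : ℕ} (hl : 0 < l) {τ c c' : ℚ} (hτ : -1 < τ) {P Q : LFrac K}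
    (hP : P ∈ fil l τ c) (hQ : Q ∈ fil l τ c') :
    sym l τ (c + c') (Ore.leftMul (fracDeriv K l) P Q) = sym l τ c P * sym l τ c' Q := by
  refine fil_induction₂ (p := fun P Q => sym l τ (c + c') (Ore.leftMul (fracDeriv K l) P Q) =
    sym l τ c P * sym l τ c' Q) ?_ ?_ ?_ ?_ ?_ hP hQ
  · intro Q; simp
  · intro P; simp
  · intro P P' Q h h'; simp only [map_add, LinearMap.add_apply, h, h', add_mul]
  · intro P Q Q' h h'; simp only [map_add, h, h', mul_add]
  · intro i j a i' j' b h h'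
    have h1 := sym_eq_zero_of_mem_fil (c := c + c')
      (leftMul_mon_mon_sub_mem_fil hl hτ.le i i' j j' a b) (by linarith)
    rw [map_sub, sub_eq_zero] at h1
    rw [h1, sym_mon, sym_mon, sym_mon, wt_add]
    rcases h.lt_or_eq with h | h
    · rw [if_neg (by linarith), if_neg h.ne, zero_mul]
    rcases h'.lt_or_eq with h' | h'
    · rw [if_neg (by linarith), if_neg h'.ne, mul_zero]
    rw [if_pos (by linarith), if_pos h, if_pos h', Polynomial.monomial_mul_monomial]

/-- Absorbs truncated subtraction in exponents: they disagree only where the coefficient is zero. -/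
theorem monomial_eq_of_or (j k : ℕ) (a : K) (h : a = 0 ∨ j = k) :
    Polynomial.monomial j a = Polynomial.monomial k a := by
  rcases h with rfl | rfl <;> simp

theorem commutator_mon_mon {l : ℕ} (hl : 0 < l) {τ : ℚ} (hτ : -1 ≤ τ) (i i' : ℤ) (j j' : ℕ)
    (a b : K) :
    Ore.leftMul (fracDeriv K l) (mon i j a) (mon i' j' b) -
      Ore.leftMul (fracDeriv K l) (mon i' j' b) (mon i j a)
      - mon (i + i' - l) (j + j' - 1) ((j * ((i' : K) / l) - j' * ((i : K) / l)) * (a * b)) ∈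
      fil l τ (wt l τ i j + wt l τ i' j' - 2 * (1 + τ)) := by
  have h := leftMul_mon_mon hl hτ i i' j j' a b
  have h' := leftMul_mon_mon hl hτ i' i j' j b a
  rw [add_comm (wt l τ i' j'), add_comm i' i, add_comm j' j, mul_comm b a] at h'
  have := sub_mem h h'
  convert this using 1
  rw [sub_mul, sub_eq_add_neg (_ * (a * b)), mon_add]
  have hneg : ∀ (i : ℤ) (j : ℕ) (x : K), mon i j (-x) = - mon i j x := by
    intro i j x
    rw [eq_neg_iff_add_eq_zero, ← mon_add, neg_add_cancel, mon_zero]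
  rw [hneg]
  abel

theorem commutator_mem_fil {l : ℕ} (hl : 0 < l) {τ c c' : ℚ} (hτ : -1 ≤ τ) {P Q : LFrac K}
    (hP : P ∈ fil l τ c) (hQ : Q ∈ fil l τ c') :
    Ore.leftMul (fracDeriv K l) P Q - Ore.leftMul (fracDeriv K l) Q P ∈
      fil l τ (c + c' - (1 + τ)) := by
  refine fil_induction₂ (p := fun P Q => Ore.leftMul (fracDeriv K l) P Q -
    Ore.leftMul (fracDeriv K l) Q P ∈ fil l τ (c + c' - (1 + τ))) ?_ ?_ ?_ ?_ ?_ hP hQ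
  · intro Q; simp
  · intro P; simp
  · intro P P' Q h h'
    simp only [map_add, LinearMap.add_apply]
    convert add_mem h h' using 1
    abel
  · intro P Q Q' h h'
    simp only [map_add, LinearMap.add_apply]
    convert add_mem h h' using 1
    abel
  · intro i j a i' j' b h h'
    have h1 := leftMul_mon_mon_sub_mem_fil hl hτ i i' j j' a b
    have h2 := leftMul_mon_mon_sub_mem_fil hl hτ i' i j' j b a
    rw [add_comm i', add_comm j', add_comm (wt l τ i' j'), mul_comm b] at h2
    have h3 := fil_mono (c' := c + c' - (1 + τ)) (by linarith) (sub_mem h1 h2)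
    convert h3 using 1
    abel

/-- The products of two monomials in either order agree in top weight, and the next term has
coefficient j i'/l - j' i/l. Substituting i/l = c - τ j and i'/l = c' - τ j', the terms τ j j'
cancel and c' j - c j' remains, which is the Wronskian of z^j and z^j'. -/
theorem sym_commutator [CharZero K] {l : ℕ} (hl : 0 < l) {τ c c' : ℚ} (hτ : -1 < τ)
    {P Q : LFrac K} (hP : P ∈ fil l τ c) (hQ : Q ∈ fil l τ c') :
    sym l τ (c + c' - (1 + τ))
      (Ore.leftMul (fracDeriv K l) P Q - Ore.leftMul (fracDeriv K l) Q P) =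
    (c' : K) • (derivative (sym l τ c P) * sym l τ c' Q) -
      (c : K) • (sym l τ c P * derivative (sym l τ c' Q)) := by
  refine fil_induction₂ (p := fun P Q => sym l τ (c + c' - (1 + τ))
      (Ore.leftMul (fracDeriv K l) P Q - Ore.leftMul (fracDeriv K l) Q P) =
    (c' : K) • (derivative (sym l τ c P) * sym l τ c' Q) -
      (c : K) • (sym l τ c P * derivative (sym l τ c' Q))) ?_ ?_ ?_ ?_ ?_ hP hQ
  · intro Q; simp
  · intro P; simp
  · intro P P' Q h h'
    generalize c + c' - (1 + τ) = d at h h' ⊢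
    simp only [map_add, map_sub, LinearMap.add_apply, add_mul, smul_add] at h h' ⊢
    rw [add_sub_add_comm, h, h']
    abel
  · intro P Q Q' h h'
    generalize c + c' - (1 + τ) = d at h h' ⊢
    simp only [map_add, map_sub, LinearMap.add_apply, mul_add, smul_add] at h h' ⊢
    rw [add_sub_add_comm, h, h']
    abel
  · intro i j a i' j' b h h'
    rcases eq_or_lt_of_le (add_le_add h h') with heq | hlt
    · have e : wt l τ i j = c := by linarith
      have e' : wt l τ i' j' = c' := by linarith
      have h1 := sym_eq_zero_of_mem_fil (c := c + c' - (1 + τ))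
        (commutator_mon_mon hl hτ.le i i' j j' a b) (by linarith)
      rw [map_sub, sub_eq_zero] at h1
      rw [h1, sym_mon, sym_mon, sym_mon, if_pos e, if_pos e']
      have hs : ((c' : K) * j - c * j') = j * ((i' : K) / l) - j' * ((i : K) / l) := by
        rw [← e, ← e']
        simp only [wt]
        push_cast
        ring
      rw [Polynomial.derivative_monomial, Polynomial.derivative_monomial,
        Polynomial.monomial_mul_monomial, Polynomial.monomial_mul_monomial, ← hs,
        monomial_eq_of_or (j - 1 + j') (j + j' - 1) (a * j * b)
          (j.eq_zero_or_pos.elim (fun h => .inl (by simp [h])) (fun h => .inr (by omega))),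
        monomial_eq_of_or (j + (j' - 1)) (j + j' - 1) (a * (b * j'))
          (j'.eq_zero_or_pos.elim (fun h => .inl (by simp [h])) (fun h => .inr (by omega))),
        Polynomial.smul_monomial, Polynomial.smul_monomial, ← map_sub (Polynomial.monomial _),
        show ((c' : K) * j - c * j') * (a * b) = (c' : K) • (a * j * b) - (c : K) • (a * (b * j')) by
          simp only [smul_eq_mul]; ring]
      rcases Nat.eq_zero_or_pos (j + j') with h0 | h0
      · obtain ⟨rfl, rfl⟩ : j = 0 ∧ j' = 0 := by omega
        simp
      · rw [if_pos]
        obtain ⟨k, hk⟩ := Nat.exists_eq_add_of_le' h0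
        have h2 := wt_add l τ i i' j j'
        rw [hk, Nat.succ_eq_add_one, Nat.zero_add, wt_succ] at h2
        rw [hk, Nat.succ_eq_add_one, Nat.zero_add, Nat.add_sub_cancel, wt_sub hl]
        linarith
    · have h1 := sym_eq_zero_of_mem_fil (c := c + c' - (1 + τ))
        (commutator_mem_fil hl hτ.le (mon_mem_fil a (le_refl (wt l τ i j)))
          (mon_mem_fil b (le_refl (wt l τ i' j')))) (by linarith)
      rw [h1, sym_mon, sym_mon]
      rcases h.lt_or_eq with h | h
      · rw [if_neg h.ne]; simp
      · rw [if_neg (c := wt l τ i' j' = c') (by intro h2; linarith)]; simp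

end LFrac

end

/-! ### Weighted Wronskians of polynomials in one variable. -/

noncomputable section

namespace Polynomial

variable {K : Type*} [Field K]

/-- The weighted Wronskian `a h' p - e h p'`. -/
def brk (a e : K) (h p : K[X]) : K[X] :=
  C a * (derivative h * p) - C e * (h * derivative p)

theorem X_sub_C_mul_derivative_pow (α : K) (j : ℕ) :
    (X - C α) * derivative ((X - C α) ^ j) = C (j : K) * (X - C α) ^ j := by
  rw [derivative_X_sub_C_pow]
  rcases j with _ | j
  · simp
  · simp only [Nat.add_sub_cancel, pow_succ, map_natCast]
    ring

/-- Local expansion at α; the extra factor X - α avoids the exponents j - 1 and k - 1. The number a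
j - e k decides whether the order of the Wronskian at α is exactly j + k - 1. -/
theorem X_sub_C_mul_brk (a e α : K) (j k : ℕ) (h p : K[X]) :
    (X - C α) * brk a e ((X - C α) ^ j * h) ((X - C α) ^ k * p) =
      (X - C α) ^ (j + k) * (C (a * j - e * k) * (h * p) + (X - C α) * brk a e h p) := by
  have hj := X_sub_C_mul_derivative_pow α j
  have hk := X_sub_C_mul_derivative_pow α k
  simp only [brk, derivative_mul, map_sub, map_mul, pow_add]
  linear_combination (C a * h * (X - C α) ^ k * p) * hj - (C e * p * (X - C α) ^ j * h) * hk

theorem natDegree_X_mul_derivative_le (q : K[X]) : (X * derivative q).natDegree ≤ q.natDegree := by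
  rcases Nat.eq_zero_or_pos q.natDegree with h0 | h0
  · rw [eq_C_of_natDegree_eq_zero h0]; simp
  · refine natDegree_mul_le.trans ?_
    have := natDegree_derivative_le q
    rw [natDegree_X]
    omega

/-- The analogue at infinity of the local expansion at a root; the factor X again compensates the
lost degree. -/
theorem coeff_X_mul_brk (a e : K) (h p : K[X]) :
    (X * brk a e h p).coeff (h.natDegree + p.natDegree) =
      (a * h.natDegree - e * p.natDegree) * (h.leadingCoeff * p.leadingCoeff) := by
  have hX : ∀ q : K[X], (X * derivative q).coeff q.natDegree = q.natDegree * q.leadingCoeff := by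
    intro q
    rcases Nat.eq_zero_or_pos q.natDegree with h0 | h0
    · rw [h0]; simp
    · obtain ⟨k, hk⟩ := Nat.exists_eq_add_of_le' h0
      rw [leadingCoeff, hk, coeff_X_mul, coeff_derivative]
      push_cast; ring
  have e1 : X * brk a e h p =
      C a * ((X * derivative h) * p) - C e * (h * (X * derivative p)) := by
    simp only [brk]; ring
  rw [e1, coeff_sub, coeff_C_mul, coeff_C_mul, coeff_mul_add_eq_of_natDegree_le (natDegree_X_mul_derivative_le h) le_rfl,
    coeff_mul_add_eq_of_natDegree_le le_rfl (natDegree_X_mul_derivative_le p), hX, hX]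
  simp only [leadingCoeff]
  ring

theorem natDegree_brk_le (a e : K) (h p : K[X]) :
    (X * brk a e h p).natDegree ≤ h.natDegree + p.natDegree := by
  have e1 : X * brk a e h p =
      C a * ((X * derivative h) * p) - C e * (h * (X * derivative p)) := by
    simp only [brk]; ring
  rw [e1]
  refine (natDegree_sub_le _ _).trans (max_le ?_ ?_)
  · refine (natDegree_C_mul_le _ _).trans (natDegree_mul_le.trans ?_)
    have := natDegree_X_mul_derivative_le h
    omega
  · refine (natDegree_C_mul_le _ _).trans (natDegree_mul_le.trans ?_)
    have := natDegree_X_mul_derivative_le p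
    omega

theorem natDegree_eq_of_brk_eq_zero {a e : K} {h p : K[X]} (hh : h ≠ 0) (hp : p ≠ 0)
    (hb : brk a e h p = 0) : a * h.natDegree = e * p.natDegree := by
  have h1 := coeff_X_mul_brk a e h p
  rw [hb, mul_zero, coeff_zero] at h1
  have h2 : h.leadingCoeff * p.leadingCoeff ≠ 0 := by simp [hh, hp]
  have := (mul_eq_zero.1 h1.symm).resolve_right h2
  linear_combination this

theorem natDegree_brk {a e : K} {h p : K[X]} (hh : h ≠ 0) (hp : p ≠ 0)
    (hne : a * h.natDegree ≠ e * p.natDegree) :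
    (brk a e h p).natDegree + 1 = h.natDegree + p.natDegree := by
  have h1 := coeff_X_mul_brk a e h p
  have h2 : h.leadingCoeff * p.leadingCoeff ≠ 0 := by simp [hh, hp]
  have h3 : (X * brk a e h p).coeff (h.natDegree + p.natDegree) ≠ 0 := by
    rw [h1]; exact mul_ne_zero (sub_ne_zero.2 hne) h2
  have h4 := le_antisymm (natDegree_brk_le a e h p) (le_natDegree_of_ne_zero h3)
  have h5 : brk a e h p ≠ 0 := by
    intro h0; rw [h0] at h3; simp at h3
  rw [natDegree_X_mul h5] at h4
  exact h4

theorem rootMultiplicity_eq_of_brk_eq_zero {a e : K} {h p : K[X]} (hh : h ≠ 0) (hp : p ≠ 0)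
    (hb : brk a e h p = 0) (α : K) : a * h.rootMultiplicity α = e * p.rootMultiplicity α := by
  obtain ⟨h0, e0, hd0⟩ := exists_eq_pow_rootMultiplicity_mul_and_not_dvd h hh α
  obtain ⟨p0, e1, hd1⟩ := exists_eq_pow_rootMultiplicity_mul_and_not_dvd p hp α
  rw [dvd_iff_isRoot, IsRoot] at hd0 hd1
  have key := X_sub_C_mul_brk a e α (h.rootMultiplicity α) (p.rootMultiplicity α) h0 p0
  rw [← e0, ← e1, hb, mul_zero] at key
  have := (mul_eq_zero.1 key.symm).resolve_left (pow_ne_zero _ (X_sub_C_ne_zero α))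
  have h2 := congrArg (eval α) this
  simp only [eval_add, eval_mul, eval_C, eval_sub, eval_X, sub_self, zero_mul, add_zero,
    eval_zero] at h2
  have := (mul_eq_zero.1 h2).resolve_right (mul_ne_zero hd0 hd1)
  linear_combination this

theorem rootMultiplicity_brk {a e : K} {h p : K[X]} (hh : h ≠ 0) (hp : p ≠ 0) (α : K)
    (hne : a * h.rootMultiplicity α ≠ e * p.rootMultiplicity α) :
    (brk a e h p).rootMultiplicity α + 1 = h.rootMultiplicity α + p.rootMultiplicity α := by
  obtain ⟨h0, e0, hd0⟩ := exists_eq_pow_rootMultiplicity_mul_and_not_dvd h hh α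
  obtain ⟨p0, e1, hd1⟩ := exists_eq_pow_rootMultiplicity_mul_and_not_dvd p hp α
  rw [dvd_iff_isRoot, IsRoot] at hd0 hd1
  have key := X_sub_C_mul_brk a e α (h.rootMultiplicity α) (p.rootMultiplicity α) h0 p0
  rw [← e0, ← e1] at key
  set u := C (a * h.rootMultiplicity α - e * p.rootMultiplicity α) * (h0 * p0) +
    (X - C α) * brk a e h0 p0 with hu
  have hu0 : eval α u ≠ 0 := by
    simp only [hu, eval_add, eval_mul, eval_C, eval_sub, eval_X, sub_self, zero_mul, add_zero]
    exact mul_ne_zero (sub_ne_zero.2 hne) (mul_ne_zero hd0 hd1)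
  have hune : u ≠ 0 := by rintro h; rw [h] at hu0; simp at hu0
  have hx := X_sub_C_ne_zero α
  have hb : brk a e h p ≠ 0 := by
    intro h0
    rw [h0, mul_zero] at key
    exact mul_ne_zero (pow_ne_zero _ hx) hune key.symm
  have h2 := congrArg (rootMultiplicity α) key
  rw [rootMultiplicity_mul (mul_ne_zero hx hb), rootMultiplicity_X_sub_C_self,
    rootMultiplicity_mul (mul_ne_zero (pow_ne_zero _ hx) hune), rootMultiplicity_X_sub_C_pow,
    rootMultiplicity_eq_zero hu0] at h2
  omega

theorem dvd_of_rootMultiplicity_le [IsAlgClosed K] {p q : K[X]} (hp : p ≠ 0)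
    (h : ∀ α, p.rootMultiplicity α ≤ q.rootMultiplicity α) : p ∣ q := by
  classical
  refine (IsAlgClosed.splits p).dvd_of_roots_le_roots hp ?_
  rw [Multiset.le_iff_count]
  intro α
  rw [count_roots, count_roots]
  exact h α

theorem eq_C_mul_X_sub_C_pow [IsAlgClosed K] {p : K[X]} {α : K}
    (h : ∀ β, β ≠ α → p.rootMultiplicity β = 0) :
    p = C p.leadingCoeff * (X - C α) ^ p.natDegree := by
  classical
  rcases eq_or_ne p 0 with rfl | hp
  · simp
  have hs := IsAlgClosed.splits p
  have hr : p.roots = Multiset.replicate p.natDegree α := by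
    rw [Multiset.eq_replicate, splits_iff_card_roots.1 hs]
    refine ⟨rfl, fun β hβ => ?_⟩
    by_contra hne
    have := h β hne
    rw [← count_roots] at this
    exact Multiset.count_ne_zero.2 hβ this
  conv_lhs => rw [hs.eq_prod_roots, hr]
  simp

theorem exists_eq_C_mul_pow [IsAlgClosed K] {p : K[X]} {m : ℕ}
    (h : ∀ α, m ∣ p.rootMultiplicity α) : ∃ g : K[X], p = C p.leadingCoeff * g ^ m := by
  classical
  have hs := IsAlgClosed.splits p
  refine ⟨∏ α ∈ p.roots.toFinset, (X - C α) ^ (p.rootMultiplicity α / m), ?_⟩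
  conv_lhs => rw [hs.eq_prod_roots]
  congr 1
  rw [Finset.prod_multiset_map_count, ← Finset.prod_pow]
  refine Finset.prod_congr rfl fun α _ => ?_
  rw [count_roots, ← pow_mul, Nat.div_mul_cancel (h α)]

/-- With logarithmic derivatives: a h'/h - e p'/p = 1/f and a h1'/h1 = e1 p'/p, while f = h p / h1
gives f'/f = h'/h + p'/p - h1'/h1. Hence a f'/f = 1/f + s p'/p. -/
theorem derivative_relation {a s e e1 : K} {h p h1 f : K[X]} (h1ne : h1 ≠ 0)
    (hh1 : h1 = brk a e h p) (hcomm : brk a e1 h1 p = 0) (he1 : e1 = e + a - s)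
    (hf : h * p = h1 * f) : brk a s f p = p := by
  have D : derivative h * p + h * derivative p = derivative h1 * f + h1 * derivative f := by
    rw [← derivative_mul, hf, derivative_mul]
  apply mul_left_cancel₀ h1ne
  simp only [brk] at hh1 hcomm ⊢
  have he : C e1 = C e + C a - C s := by rw [he1]; simp
  linear_combination (-(C a * p)) * D - f * hcomm + (C e1 * derivative p) * hf +
    (C s * derivative p) * hf - p * hh1 - (h * p * derivative p) * he

/-- The leading form that normalises the bracket: a polynomial solution `f` of
`a f' p - s f p' = p`. -/
theorem exists_brk_eq_self [IsAlgClosed K] [CharZero K] {a s e e1 : ℚ} {h p h1 : K[X]}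
    (hp : p ≠ 0) (h1ne : h1 ≠ 0) (ha : 0 < a) (hs : 0 < s)
    (hh1 : h1 = brk (a : K) e h p) (hcomm : brk (a : K) e1 h1 p = 0) (he1 : e1 = e + a - s) :
    ∃ f : K[X], brk (a : K) s f p = p ∧ h * p = h1 * f := by
  have hh : h ≠ 0 := by
    rintro rfl
    apply h1ne
    rw [hh1]
    simp [brk]
  -- At each root, either h1 loses exactly one order against h p, or its order is read off from the
  -- vanishing Wronskian of h1 and p; in that case the term -s in e1 gives the inequality.
  have hdvd : h1 ∣ h * p := by
    refine dvd_of_rootMultiplicity_le h1ne fun α => ?_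
    rw [rootMultiplicity_mul (mul_ne_zero hh hp)]
    by_cases hc : (a : K) * h.rootMultiplicity α = e * p.rootMultiplicity α
    · have h2 := rootMultiplicity_eq_of_brk_eq_zero h1ne hp hcomm α
      have hc' : a * h.rootMultiplicity α = e * p.rootMultiplicity α := by exact_mod_cast hc
      have h2' : a * h1.rootMultiplicity α = e1 * p.rootMultiplicity α := by exact_mod_cast h2
      have h3 : a * h1.rootMultiplicity α ≤
          a * ((h.rootMultiplicity α : ℚ) + p.rootMultiplicity α) := by
        rw [h2', he1, mul_add, hc']
        have : 0 ≤ s * (p.rootMultiplicity α : ℚ) := by positivity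
        linarith
      have h4 := le_of_mul_le_mul_left h3 ha
      exact_mod_cast h4
    · have := rootMultiplicity_brk hh hp α hc
      rw [← hh1] at this
      omega
  obtain ⟨f, hf⟩ := hdvd
  exact ⟨f, derivative_relation h1ne hh1 hcomm (by rw [he1]; push_cast; ring) hf, hf⟩

/-- The logarithmic derivatives are μ g'/g and m g'/g, so the two terms of the Wronskian cancel. -/
theorem brk_pow_eq_zero {a s : K} {μ m : ℕ} (h : a * μ = s * m) (c d : K) (g : K[X]) :
    brk a s (C d * g ^ μ) (C c * g ^ m) = 0 := by
  have hg : ∀ j : ℕ, g * derivative (g ^ j) = C (j : K) * g ^ j * derivative g := by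
    intro j
    rw [derivative_pow]
    rcases j with _ | j
    · simp
    · simp only [Nat.add_sub_cancel, pow_succ, map_natCast]
      ring
  rcases eq_or_ne g 0 with rfl | hg0
  · rcases μ with _ | μ <;> rcases m with _ | m <;> simp [brk]
  apply mul_left_cancel₀ hg0
  have h' : C a * C (μ : K) = C s * C (m : K) := by rw [← C_mul, ← C_mul, h]
  have h1 := hg μ
  have h2 := hg m
  simp only [brk, derivative_mul, derivative_C]
  linear_combination (C a * C d * C c * g ^ m) * h1 - (C s * C d * C c * g ^ μ) * h2 +
    (C d * C c * g ^ μ * g ^ m * derivative g) * h'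

theorem brk_sub_left (a s : K) (f f' p : K[X]) : brk a s (f - f') p = brk a s f p - brk a s f' p := by
  simp only [brk, derivative_sub]
  ring

/-- With f = β (X - α) the equation becomes s β (X - α) p' = (a β - 1) p, so p vanishes nowhere but
possibly at α. -/
theorem eq_C_mul_X_sub_C_pow_of_natDegree_eq_one [IsAlgClosed K] [CharZero K] {a s : K} {f p : K[X]}
    (hs : s ≠ 0) (hp : p ≠ 0) (hf : f.natDegree = 1) (hb : brk a s f p = p) :
    ∃ α, p = C p.leadingCoeff * (X - C α) ^ p.natDegree := by
  classical
  obtain ⟨β, hβ, γ, rfl⟩ := natDegree_eq_one.1 hf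
  refine ⟨-γ / β, eq_C_mul_X_sub_C_pow fun δ hδ => ?_⟩
  have h1 : brk (s * β) (a * β - 1) p (X - C (-γ / β)) = 0 := by
    have e : (C β * X + C γ : K[X]) = C β * (X - C (-γ / β)) := by
      rw [mul_sub, ← C_mul, mul_div_cancel₀ _ hβ, C_neg, sub_neg_eq_add]
    rw [e] at hb
    simp only [brk, derivative_mul, map_sub, derivative_X, derivative_C, map_mul,
      map_one] at hb ⊢
    linear_combination -hb
  have h2 := rootMultiplicity_eq_of_brk_eq_zero hp (X_sub_C_ne_zero _) h1 δ
  rw [rootMultiplicity_X_sub_C, if_neg hδ, Nat.cast_zero, mul_zero] at h2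
  simpa [hs, hβ] using h2

/-- Unless its top coefficient cancels, the Wronskian of f and p has degree deg f + deg p - 1; here
this is deg p. -/
theorem natDegree_eq_one_of_brk_eq_self [CharZero K] {a s : ℚ} {f p : K[X]} (hp : p ≠ 0)
    (hb : brk (a : K) s f p = p) (hne : a * f.natDegree ≠ s * p.natDegree) : f.natDegree = 1 := by
  have hf : f ≠ 0 := by
    rintro rfl
    apply hp
    rw [← hb]
    simp [brk]
  have := natDegree_brk hf hp (a := (a : K)) (e := s) (by exact_mod_cast hne)
  rw [hb] at this
  omega

/-- If `a f' p - s f p' = p`, where the root multiplicities of `p` are divisible by `m`,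
then `p` has only one root. -/
theorem exists_eq_C_mul_X_sub_C_pow [IsAlgClosed K] [CharZero K] {a s : ℚ} (hs : 0 < s)
    {f p : K[X]} {m r : ℕ} (hm : 0 < m) (hp : p ≠ 0) (hb : brk (a : K) s f p = p)
    (hroot : ∀ α, m ∣ p.rootMultiplicity α) (hr : p.natDegree = m * r) (hr0 : 0 < r)
    (hμ : a * f.natDegree = s * p.natDegree →
      ∃ μ : ℕ, f.natDegree = μ * r ∧ a * μ = s * m) :
    ∃ α, p = C p.leadingCoeff * (X - C α) ^ p.natDegree := by
  have hsK : (s : K) ≠ 0 := by exact_mod_cast hs.ne'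
  by_cases hc : a * f.natDegree = s * p.natDegree
  · obtain ⟨μ, hfμ, haμ⟩ := hμ hc
    obtain ⟨g, hg⟩ := exists_eq_C_mul_pow hroot
    have hlc : p.leadingCoeff ≠ 0 := leadingCoeff_ne_zero.2 hp
    have hg0 : g ≠ 0 := by
      rintro rfl
      apply hp
      rw [hg, zero_pow hm.ne', mul_zero]
    have hgr : g.natDegree = r := by
      have h1 := congrArg natDegree hg
      rw [natDegree_C_mul hlc, natDegree_pow, hr] at h1
      exact (Nat.eq_of_mul_eq_mul_left hm h1).symm
    have haμK : (a : K) * μ = s * m := by exact_mod_cast haμ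
    -- The power g^μ has zero Wronskian with p, so subtracting κ g^μ keeps the equation, and κ is
    -- chosen to kill the top term of f. The degree balance then fails, which leaves degree 1.
    set κ := f.leadingCoeff / g.leadingCoeff ^ μ with hκ
    have hb1 : brk (a : K) s (f - C κ * g ^ μ) p = p := by
      rw [brk_sub_left, hb]
      have := brk_pow_eq_zero haμK p.leadingCoeff κ g
      rw [← hg] at this
      rw [this, sub_zero]
    by_cases hc1 : a * (f - C κ * g ^ μ).natDegree = s * p.natDegree
    · exfalso
      have ha : a ≠ 0 := by
        rintro rfl
        rw [zero_mul] at hc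
        have : s * (p.natDegree : ℚ) ≠ 0 := by
          have : (p.natDegree : ℚ) ≠ 0 := by rw [hr]; positivity
          positivity
        exact this hc.symm
      have hdeg : (f - C κ * g ^ μ).natDegree = f.natDegree := by
        have := mul_left_cancel₀ ha (hc1.trans hc.symm)
        exact_mod_cast this
      have hf1 : f - C κ * g ^ μ ≠ 0 := by
        intro h0
        rw [h0] at hb1
        apply hp
        rw [← hb1]
        simp [brk]
      have : (f - C κ * g ^ μ).coeff f.natDegree = 0 := by
        have h2 : (g ^ μ).coeff f.natDegree = g.leadingCoeff ^ μ := by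
          rw [hfμ, ← hgr, ← natDegree_pow, ← leadingCoeff_pow]
          rfl
        rw [coeff_sub, coeff_C_mul, h2, hκ, div_mul_cancel₀ _
          (pow_ne_zero _ (leadingCoeff_ne_zero.2 hg0))]
        exact sub_self _
      rw [← hdeg] at this
      exact hf1 (leadingCoeff_eq_zero.1 this)
    · exact eq_C_mul_X_sub_C_pow_of_natDegree_eq_one hsK hp
        (natDegree_eq_one_of_brk_eq_self hp hb1 hc1) hb1
  · exact eq_C_mul_X_sub_C_pow_of_natDegree_eq_one hsK hp
      (natDegree_eq_one_of_brk_eq_self hp hb hc) hb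

end Polynomial

end

/-! ### The subalgebra generated by P and Q. -/

noncomputable section

namespace WeylFrac

open Polynomial LFrac

variable {K : Type*} [Field K] {l : ℕ}

theorem Psi_mul (P Q : WeylFrac K l) :
    Psi K l (P * Q) = Ore.leftMul (fracDeriv K l) (Psi K l P) (Psi K l Q) := rfl

theorem Psi_one : Psi K l 1 = mon 0 0 1 := by
  change (1 : LFrac K) = _
  rw [mon, Polynomial.monomial_zero_left]
  rfl

theorem smul_mul (c : K) (P Q : WeylFrac K l) : c • P * Q = c • (P * Q) := by
  apply (Psi K l).injective
  rw [Psi_mul, map_smul, map_smul, map_smul, LinearMap.smul_apply, Psi_mul]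

theorem mul_smul' (c : K) (P Q : WeylFrac K l) : P * c • Q = c • (P * Q) := by
  apply (Psi K l).injective
  rw [Psi_mul, map_smul, map_smul, map_smul, Psi_mul]

theorem one_ne_zero' : (1 : WeylFrac K l) ≠ 0 := by
  intro h
  have h1 : Psi K l 1 = 0 := by rw [h, map_zero]
  have h2 := coeff_mon (K := K) 0 0 0 0 1
  rw [← Psi_one (l := l), h1] at h2
  simp at h2

theorem mul_mem_fil (hl : 0 < l) {τ c c' : ℚ} (hτ : -1 ≤ τ) {P Q : WeylFrac K l}
    (hP : Psi K l P ∈ fil l τ c) (hQ : Psi K l Q ∈ fil l τ c') :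
    Psi K l (P * Q) ∈ fil l τ (c + c') :=
  leftMul_mem_fil hl hτ hP hQ

theorem one_mem_fil (τ : ℚ) : Psi K l 1 ∈ fil l τ 0 := by
  rw [Psi_one]
  exact mon_mem_fil _ (by simp [wt])

theorem pow_mem_fil (hl : 0 < l) {τ c : ℚ} (hτ : -1 ≤ τ) {P : WeylFrac K l}
    (hP : Psi K l P ∈ fil l τ c) (k : ℕ) : Psi K l (P ^ k) ∈ fil l τ (k * c) := by
  induction k with
  | zero => simpa using one_mem_fil τ
  | succ k ih =>
    rw [pow_succ, show ((k + 1 : ℕ) : ℚ) * c = k * c + c by push_cast; ring]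
    exact mul_mem_fil hl hτ ih hP

theorem bracket_mem_fil (hl : 0 < l) {τ c c' : ℚ} (hτ : -1 ≤ τ) {P Q : WeylFrac K l}
    (hP : Psi K l P ∈ fil l τ c) (hQ : Psi K l Q ∈ fil l τ c') :
    Psi K l (P * Q - Q * P) ∈ fil l τ (c + c' - (1 + τ)) := by
  rw [map_sub]
  exact commutator_mem_fil hl hτ hP hQ

theorem sym_bracket [CharZero K] (hl : 0 < l) {τ c c' : ℚ} (hτ : -1 < τ) {P Q : WeylFrac K l}
    (hP : Psi K l P ∈ fil l τ c) (hQ : Psi K l Q ∈ fil l τ c') :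
    sym l τ (c + c' - (1 + τ)) (Psi K l (P * Q - Q * P)) =
      brk (c' : K) c (sym l τ c (Psi K l P)) (sym l τ c' (Psi K l Q)) := by
  rw [map_sub, Psi_mul, Psi_mul, sym_commutator hl hτ hP hQ, brk, smul_eq_C_mul, smul_eq_C_mul]

/-- The linear map `∑ g_k Y ^ k ↦ ∑ g_k(P) Q ^ k`. -/
def orderedEval (P Q : WeylFrac K l) : K[X][X] →ₗ[K] WeylFrac K l :=
  lsum fun k => lsum fun i => LinearMap.toSpanSingleton K (WeylFrac K l) (P ^ i * Q ^ k)

theorem orderedEval_monomial (P Q : WeylFrac K l) (i k : ℕ) (c : K) :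
    orderedEval P Q (Polynomial.monomial k (Polynomial.monomial i c)) = c • (P ^ i * Q ^ k) := by
  simp [orderedEval]

theorem induction_monomial₂ {p : K[X][X] → Prop} (hadd : ∀ G H, p G → p H → p (G + H))
    (hmon : ∀ i k c, p (Polynomial.monomial k (Polynomial.monomial i c))) (G : K[X][X]) : p G := by
  induction G using Polynomial.induction_on' with
  | add G H hG hH => exact hadd G H hG hH
  | monomial k g =>
    induction g using Polynomial.induction_on' with
    | add g h hg hh => rw [map_add]; exact hadd _ _ hg hh
    | monomial i c => exact hmon i k c

theorem pow_mul_sub {R : Type*} [Ring R] {P Q : R} (h : Q * P - P * Q = 1) (k : ℕ) :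
    Q ^ k * P - P * Q ^ k = k * Q ^ (k - 1) := by
  induction k with
  | zero => simp
  | succ k ih =>
    have h1 : Q ^ (k + 1) * P - P * Q ^ (k + 1) =
        Q ^ k * (Q * P - P * Q) + (Q ^ k * P - P * Q ^ k) * Q := by
      rw [pow_succ]; noncomm_ring
    rw [h1, h, ih]
    rcases k with _ | k
    · simp
    · simp only [Nat.add_sub_cancel]
      push_cast
      rw [mul_assoc, ← pow_succ]
      noncomm_ring

theorem mul_pow_sub {R : Type*} [Ring R] {P Q : R} (h : Q * P - P * Q = 1) (k : ℕ) :
    Q * P ^ k - P ^ k * Q = k * P ^ (k - 1) := by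
  have h1 := pow_mul_sub (P := -Q) (Q := P) (by rw [← h]; noncomm_ring) k
  rw [← h1]
  noncomm_ring

/-- Powers of P stand on the left and commute with P, so the bracket with P acts only on Q^k, as
d/dQ. -/
theorem orderedEval_bracket {P Q : WeylFrac K l} (h : Q * P - P * Q = 1) (G : K[X][X]) :
    orderedEval P Q G * P - P * orderedEval P Q G = orderedEval P Q (derivative G) := by
  refine induction_monomial₂ (p := fun G => orderedEval P Q G * P - P * orderedEval P Q G =
    orderedEval P Q (derivative G)) ?_ ?_ G
  · intro G H hG hH
    rw [map_add, map_add, map_add, ← hG, ← hH]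
    noncomm_ring
  · intro i k c
    have hk : (Polynomial.monomial i c * (k : K[X])) = Polynomial.monomial i (c * k) := by
      rw [← C_eq_natCast, mul_comm, C_mul_monomial, mul_comm]
    rw [derivative_monomial, hk, orderedEval_monomial, orderedEval_monomial, smul_mul, mul_smul',
      ← smul_sub, mul_smul, mul_assoc, ← mul_assoc P, ← pow_succ', pow_succ, mul_assoc (P ^ i) P,
      ← mul_sub, pow_mul_sub h, ← nsmul_eq_mul, mul_smul_comm, Nat.cast_smul_eq_nsmul]

theorem bracket_orderedEval_C {P Q : WeylFrac K l} (h : Q * P - P * Q = 1) (g : K[X]) :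
    Q * orderedEval P Q (Polynomial.C g) - orderedEval P Q (Polynomial.C g) * Q =
      orderedEval P Q (Polynomial.C (derivative g)) := by
  induction g using Polynomial.induction_on' with
  | add g g' hg hg' =>
    simp only [map_add]
    rw [← hg, ← hg']
    noncomm_ring
  | monomial i c =>
    rw [← monomial_zero_left, ← monomial_zero_left, derivative_monomial, orderedEval_monomial,
      orderedEval_monomial, smul_mul, mul_smul', ← smul_sub, pow_zero, mul_one, mul_one,
      mul_pow_sub h, mul_smul, ← nsmul_eq_mul, Nat.cast_smul_eq_nsmul]

theorem orderedEval_C_eq_zero [CharZero K] {P Q : WeylFrac K l} (h : Q * P - P * Q = 1) (g : K[X])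
    (hg : orderedEval P Q (Polynomial.C g) = 0) : g = 0 := by
  induction hn : g.natDegree using Nat.strong_induction_on generalizing g with
  | _ n ih =>
    have h1 : derivative g = 0 := by
      rcases Nat.eq_zero_or_pos n with h0 | h0
      · rw [eq_C_of_natDegree_eq_zero (hn.trans h0), derivative_C]
      · refine ih _ (hn ▸ natDegree_derivative_lt (by omega)) _ ?_ rfl
        rw [← bracket_orderedEval_C h, hg, mul_zero, zero_mul, sub_zero]
    have h2 := derivative_eq_zero.1 h1
    rw [eq_C_of_natDegree_eq_zero h2] at hg ⊢
    rw [← monomial_zero_left, ← monomial_zero_left, orderedEval_monomial, pow_zero, pow_zero,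
      mul_one] at hg
    rw [(smul_eq_zero.1 hg).resolve_right one_ne_zero', C_0]

/-- Bracketing a relation with P differentiates it in Q; by induction on the degree the derivative
is zero, so in characteristic zero the relation involves P alone, where bracketing with Q does the
same. -/
theorem orderedEval_eq_zero [CharZero K] {P Q : WeylFrac K l} (h : Q * P - P * Q = 1)
    (G : K[X][X]) (hG : orderedEval P Q G = 0) : G = 0 := by
  induction hn : G.natDegree using Nat.strong_induction_on generalizing G with
  | _ n ih =>
    have h1 : derivative G = 0 := by
      rcases Nat.eq_zero_or_pos n with h0 | h0
      · rw [eq_C_of_natDegree_eq_zero (hn.trans h0), derivative_C]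
      · refine ih _ (hn ▸ natDegree_derivative_lt (by omega)) _ ?_ rfl
        rw [← orderedEval_bracket h, hG, mul_zero, zero_mul, sub_zero]
    have h2 := derivative_eq_zero.1 h1
    rw [eq_C_of_natDegree_eq_zero h2] at hG ⊢
    rw [orderedEval_C_eq_zero h _ hG, C_0]

end WeylFrac

end

/-! ### Dimension count and the normalizing form f. -/

noncomputable section

/-- The term z^j in weight c stands for x^(c - τ j) y^j, whose x-exponent must lie in (1/l)ℤ. All
arithmetic constraints below come from this. -/
theorem LFrac.exists_int_of_sym_coeff_ne_zero {K : Type*} [Field K] {l : ℕ} (hl : 0 < l)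
    {τ c : ℚ} {j : ℕ} {P : LFrac K} (h : (sym l τ c P).coeff j ≠ 0) :
    ∃ i : ℤ, l * (c - τ * j) = i := by
  obtain ⟨i, hi⟩ := exists_of_sym_coeff_ne_zero h
  refine ⟨i, ?_⟩
  have hl' : (l : ℚ) ≠ 0 := by exact_mod_cast hl.ne'
  have : c - τ * j = i / l := by rw [← hi, wt]; ring
  rw [this]
  field_simp

namespace WeylFrac

open Polynomial LFrac

variable {K : Type*} [Field K] {l : ℕ}

/-- The polynomial `∑ c_{ik} X ^ i Y ^ k`. -/
def boxPoly (K : Type*) [Field K] (N : ℕ) : (Fin N × Fin N → K) →ₗ[K] K[X][X] :=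
  ∑ x : Fin N × Fin N, (((Polynomial.monomial (x.2 : ℕ) : K[X] →ₗ[K[X]] K[X][X]).restrictScalars K).comp
    (Polynomial.monomial (x.1 : ℕ))).comp (LinearMap.proj x)

theorem boxPoly_apply (N : ℕ) (c : Fin N × Fin N → K) : boxPoly K N c =
    ∑ x : Fin N × Fin N, Polynomial.monomial (x.2 : ℕ) (Polynomial.monomial (x.1 : ℕ) (c x)) := by
  simp [boxPoly]

theorem coeff_boxPoly (N : ℕ) (c : Fin N × Fin N → K) (x : Fin N × Fin N) :
    ((boxPoly K N c).coeff x.2).coeff x.1 = c x := by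
  rw [boxPoly_apply, finsetSum_coeff, finsetSum_coeff, Finset.sum_eq_single x]
  · simp
  · intro y _ hy
    rw [Polynomial.coeff_monomial]
    split_ifs with h2
    · rw [Polynomial.coeff_monomial, if_neg]
      intro h1
      exact hy (Prod.ext (Fin.ext h1) (Fin.ext h2))
    · simp
  · simp

theorem orderedEval_boxPoly_mem_fil (hl : 0 < l) {τ a b : ℚ} (hτ : -1 ≤ τ) {P Q : WeylFrac K l}
    (hP : Psi K l P ∈ fil l τ a) (hQ : Psi K l Q ∈ fil l τ b) (ha : 0 ≤ a) (hb : 0 ≤ b) (N : ℕ)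
    (c : Fin (N + 1) × Fin (N + 1) → K) :
    Psi K l (orderedEval P Q (boxPoly K (N + 1) c)) ∈ fil l τ (N * (a + b)) := by
  rw [boxPoly_apply, map_sum, map_sum]
  refine sum_mem fun x _ => ?_
  rw [orderedEval_monomial, map_smul]
  refine Submodule.smul_mem _ _ (fil_mono ?_
    (mul_mem_fil hl hτ (pow_mem_fil hl hτ hP x.1) (pow_mem_fil hl hτ hQ x.2)))
  have h1 : ((x.1 : ℕ) : ℚ) ≤ N := by exact_mod_cast Nat.lt_succ_iff.1 x.1.2
  have h2 : ((x.2 : ℕ) : ℚ) ≤ N := by exact_mod_cast Nat.lt_succ_iff.1 x.2.2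
  rw [mul_add]
  exact add_le_add (mul_le_mul_of_nonneg_right h1 ha) (mul_le_mul_of_nonneg_right h2 hb)

/-- The algebra generated by `P` and `Q` is too large for all its leading forms to be in
involution with the leading form of `P`. -/
theorem exists_brk_ne_zero [CharZero K] (hl : 0 < l) {τ a b : ℚ} (hτ : -1 < τ)
    {P Q : WeylFrac K l} (h : Q * P - P * Q = 1) (hP : Psi K l P ∈ fil l τ a)
    (hQ : Psi K l Q ∈ fil l τ b) (ha : 0 < a) (hb : 0 ≤ b)
    (hp : 0 < (sym l τ a (Psi K l P)).natDegree) :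
    ∃ G e, Psi K l (orderedEval P Q G) ∈ fil l τ e ∧
      brk (a : K) e (sym l τ e (Psi K l (orderedEval P Q G))) (sym l τ a (Psi K l P)) ≠ 0 := by
  by_contra! hcon
  set p := sym l τ a (Psi K l P) with hpdef
  have hp0 : p ≠ 0 := by rintro h0; rw [h0] at hp; simp at hp
  -- A form of weight e in involution with p has degree e deg p / a. Exponents of P and Q up to N
  -- give e ≤ N (a + b), so this choice of N bounds the degree by N².
  obtain ⟨N, hN⟩ := exists_nat_ge ((a + b) / a * p.natDegree)
  have hMpos : (0 : ℚ) < p.natDegree := by exact_mod_cast hp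
  have hNpos : 0 < N := by
    have : (0 : ℚ) < (a + b) / a * p.natDegree := by positivity
    exact_mod_cast this.trans_le hN
  -- Involution with p ties the degree j to the weight a j / deg p, so every possible leading
  -- coefficient is among these N² + 1 coordinates, fewer than the (N + 1)² parameters. An element
  -- of the kernel would have no leading coefficient.
  let T : (Fin (N + 1) × Fin (N + 1) → K) →ₗ[K] (Fin (N * N + 1) → K) :=
    LinearMap.pi fun j => (lcoeff K (j : ℕ)).comp ((sym l τ (a * (j : ℕ) / p.natDegree)).comp
      ((Psi K l).toLinearMap.comp ((orderedEval P Q).comp (boxPoly K (N + 1)))))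
  have hker : LinearMap.ker T ≠ ⊥ := by
    apply LinearMap.ker_ne_bot_of_finrank_lt
    simp only [Module.finrank_fintype_fun_eq_card, Fintype.card_prod, Fintype.card_fin]
    nlinarith
  obtain ⟨c, hc, hc0⟩ := Submodule.exists_mem_ne_zero_of_ne_bot hker
  set G := boxPoly K (N + 1) c with hG
  have hG0 : G ≠ 0 := by
    intro h0
    apply hc0
    ext x
    rw [← coeff_boxPoly (N + 1) c x, ← hG, h0]
    simp
  have hH0 : Psi K l (orderedEval P Q G) ≠ 0 := by
    intro h0
    exact hG0 (orderedEval_eq_zero h G ((Psi K l).map_eq_zero_iff.1 h0))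
  obtain ⟨e, he, hs⟩ := exists_sym_ne_zero hl τ hH0
  have hbr := hcon G e he
  have hdeg := natDegree_eq_of_brk_eq_zero hs hp0 hbr
  set s := sym l τ e (Psi K l (orderedEval P Q G)) with hsdef
  have hdeg' : a * s.natDegree = e * p.natDegree := by exact_mod_cast hdeg
  have hele : e ≤ N * (a + b) := by
    by_contra! hlt
    exact hs (sym_eq_zero_of_mem_fil
      (orderedEval_boxPoly_mem_fil hl hτ.le hP hQ ha.le hb N c) hlt)
  have hsN : s.natDegree ≤ N * N := by
    have h1 : (s.natDegree : ℚ) = e * p.natDegree / a := by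
      rw [← hdeg']; field_simp
    have h2 : (s.natDegree : ℚ) ≤ N * N := by
      rw [h1]
      calc e * p.natDegree / a ≤ (N * (a + b)) * p.natDegree / a := by gcongr
        _ = N * ((a + b) / a * p.natDegree) := by ring
        _ ≤ N * N := by gcongr
    exact_mod_cast h2
  have hj := congrFun (LinearMap.mem_ker.1 hc) ⟨s.natDegree, Nat.lt_succ_iff.2 hsN⟩
  have he' : a * (s.natDegree : ℚ) / p.natDegree = e := by
    rw [hdeg']; field_simp
  have hj' : s.coeff s.natDegree = 0 := by
    have : (sym l τ (a * (s.natDegree : ℚ) / p.natDegree)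
      (Psi K l (orderedEval P Q G))).coeff s.natDegree = 0 := hj
    rwa [he'] at this
  exact hs (leadingCoeff_eq_zero.1 hj')

/-- The leading form `f` with `a f' p - (1 + τ) f p' = p`, together with the fact that its top
monomial lies in the lattice of exponents of `L^{(l)}`. -/
theorem exists_normalizer [IsAlgClosed K] [CharZero K] (hl : 0 < l) {τ a b : ℚ} (hτ : -1 < τ)
    {P Q : WeylFrac K l} (h : Q * P - P * Q = 1) (hP : Psi K l P ∈ fil l τ a)
    (hQ : Psi K l Q ∈ fil l τ b) (ha : 0 < a) (hb : 0 ≤ b)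
    (hp : 0 < (sym l τ a (Psi K l P)).natDegree) :
    ∃ f : K[X], brk (a : K) (1 + τ : ℚ) f (sym l τ a (Psi K l P)) = sym l τ a (Psi K l P) ∧
      ∃ z : ℤ, l * (1 + τ - τ * f.natDegree) = z := by
  classical
  set p := sym l τ a (Psi K l P) with hpdef
  have hp0 : p ≠ 0 := by rintro h0; rw [h0] at hp; simp at hp
  have hex : ∃ d, ∃ G e, G.natDegree = d ∧ Psi K l (orderedEval P Q G) ∈ fil l τ e ∧
      brk (a : K) e (sym l τ e (Psi K l (orderedEval P Q G))) p ≠ 0 := by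
    obtain ⟨G, e, h1, h2⟩ := exists_brk_ne_zero hl hτ h hP hQ ha hb hp
    exact ⟨_, G, e, rfl, h1, h2⟩
  -- G has least degree in Q among elements not in involution with p. Its bracket with P has smaller
  -- degree, so the leading form of that bracket is in involution with p.
  obtain ⟨G, e, hGd, hGe, hGb⟩ := Nat.find_spec hex
  have hmin := fun d => Nat.find_min hex (m := d)
  set H := sym l τ e (Psi K l (orderedEval P Q G)) with hHdef
  set e1 := e + a - (1 + τ) with he1
  have hsym : sym l τ e1 (Psi K l (orderedEval P Q (derivative G))) = brk (a : K) e H p := by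
    rw [← orderedEval_bracket h, sym_bracket hl hτ hGe hP]
  have hfil : Psi K l (orderedEval P Q (derivative G)) ∈ fil l τ e1 := by
    rw [← orderedEval_bracket h]
    exact bracket_mem_fil hl hτ.le hGe hP
  have hdG : derivative G ≠ 0 := by
    intro h0
    apply hGb
    rw [← hsym, h0]
    simp
  have hlt : (derivative G).natDegree < Nat.find hex := by
    rw [← hGd]
    apply natDegree_derivative_lt
    intro h0
    exact hdG (derivative_eq_zero.2 h0)
  have hcomm : brk (a : K) e1 (brk (a : K) e H p) p = 0 := by
    by_contra hne
    exact hmin _ hlt ⟨derivative G, e1, rfl, hfil, by rwa [hsym]⟩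
  obtain ⟨f, hf, hfac⟩ := exists_brk_eq_self (s := 1 + τ) (e := e) (e1 := e1) hp0 hGb ha
    (by linarith) rfl hcomm he1
  refine ⟨f, hf, ?_⟩
  have hH0 : H ≠ 0 := by
    rintro h0
    apply hGb
    rw [h0]
    simp [brk]
  have hf0 : f ≠ 0 := by
    rintro rfl
    apply hp0
    rw [← hf]
    simp [brk]
  have hdeg : H.natDegree + p.natDegree = (brk (a : K) e H p).natDegree + f.natDegree := by
    rw [← natDegree_mul hH0 hp0, hfac, natDegree_mul hGb hf0]
  have hlat : ∀ (c : ℚ) (R : WeylFrac K l), sym l τ c (Psi K l R) ≠ 0 →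
      ∃ i : ℤ, l * (c - τ * (sym l τ c (Psi K l R)).natDegree) = i := by
    intro c R hne
    exact exists_int_of_sym_coeff_ne_zero hl
      (by rwa [coeff_natDegree, Ne, leadingCoeff_eq_zero])
  obtain ⟨i1, hi1⟩ := hlat e _ hH0
  obtain ⟨i2, hi2⟩ := hlat a P hp0
  obtain ⟨i3, hi3⟩ := hlat e1 (orderedEval P Q (derivative G)) (by rw [hsym]; exact hGb)
  rw [hsym] at hi3
  -- Since f = h p / h1, both the degree and the weight e + a - e1 = 1 + τ of f are combinations of
  -- those of three forms that come from actual elements.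
  refine ⟨i1 + i2 - i3, ?_⟩
  push_cast
  rw [← hi1, ← hi2, ← hi3, he1]
  have hdegQ : (H.natDegree : ℚ) + p.natDegree = (brk (a : K) e H p).natDegree + f.natDegree := by
    exact_mod_cast hdeg
  linear_combination ((l : ℚ) * τ) * hdegQ

end WeylFrac

end

/-! ### The automorphisms Y ↦ Y + α X^τ. -/

noncomputable section

namespace OreExtension

open Polynomial

variable {K A : Type*} [CommRing K] [CommRing A] [Algebra K A] (δ : Derivation K A A)

theorem C_mul_eq (a : A) (P : OreExtension δ) :
    C δ a * P = (toPoly δ).symm (Polynomial.C a * toPoly δ P) := by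
  apply (toPoly δ).injective
  rw [toPoly_mul, LinearEquiv.apply_symm_apply, C, LinearEquiv.apply_symm_apply,
    ← Polynomial.monomial_zero_left, Ore.leftMul_monomial, pow_zero, Module.End.one_apply,
    Polynomial.monomial_zero_left]

theorem C_mul_C (a b : A) : C δ a * C δ b = C δ (a * b) := by
  rw [C_mul_eq, C, C, LinearEquiv.apply_symm_apply, Polynomial.C_mul]

theorem C_add (a b : A) : C δ (a + b) = C δ a + C δ b := by
  simp only [C, map_add]

theorem C_zero : C δ 0 = 0 := by simp only [C, map_zero]

/-- The map `∑ a_j Y ^ j ↦ ∑ a_j y ^ j`. -/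
def substFun (y : OreExtension δ) (P : OreExtension δ) : OreExtension δ :=
  (toPoly δ P).sum fun j a => C δ a * y ^ j

theorem substFun_add (y P Q : OreExtension δ) :
    substFun δ y (P + Q) = substFun δ y P + substFun δ y Q := by
  rw [substFun, map_add, Polynomial.sum_add_index]
  · rfl
  · intro j; rw [C_zero, zero_mul]
  · intro j a b; rw [C_add, add_mul]

theorem substFun_zero (y : OreExtension δ) : substFun δ y 0 = 0 := by
  rw [substFun, map_zero, Polynomial.sum_zero_index]

theorem substFun_monomial (y : OreExtension δ) (j : ℕ) (a : A) :
    substFun δ y ((toPoly δ).symm (Polynomial.monomial j a)) = C δ a * y ^ j := by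
  rw [substFun, LinearEquiv.apply_symm_apply, Polynomial.sum_monomial_index]
  rw [C_zero, zero_mul]

theorem induction_monomial {p : OreExtension δ → Prop} (hadd : ∀ P Q, p P → p Q → p (P + Q))
    (hmon : ∀ j a, p ((toPoly δ).symm (Polynomial.monomial j a))) (P : OreExtension δ) : p P := by
  rw [← (toPoly δ).symm_apply_apply P]
  generalize toPoly δ P = f
  induction f using Polynomial.induction_on' with
  | add f g hf hg => rw [map_add]; exact hadd _ _ hf hg
  | monomial j a => exact hmon j a

theorem substFun_C_mul (y : OreExtension δ) (a : A) (P : OreExtension δ) :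
    substFun δ y (C δ a * P) = C δ a * substFun δ y P := by
  refine induction_monomial δ (p := fun P => substFun δ y (C δ a * P) = C δ a * substFun δ y P)
    ?_ ?_ P
  · intro P Q hP hQ
    rw [mul_add, substFun_add, substFun_add, hP, hQ, mul_add]
  · intro j b
    rw [C_mul_eq, LinearEquiv.apply_symm_apply, Polynomial.C_mul_monomial, substFun_monomial,
      substFun_monomial, ← mul_assoc, C_mul_C]

theorem Y_mul_monomial (j : ℕ) (a : A) : Y δ * (toPoly δ).symm (Polynomial.monomial j a) =
    (toPoly δ).symm (Polynomial.monomial (j + 1) a) +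
      (toPoly δ).symm (Polynomial.monomial j (δ a)) := by
  apply (toPoly δ).injective
  rw [toPoly_mul, map_add]
  simp only [LinearEquiv.apply_symm_apply]
  rw [Y, LinearEquiv.apply_symm_apply, ← Polynomial.monomial_one_one_eq_X, Ore.leftMul_monomial,
    pow_one, Ore.leftY_monomial, map_one, one_mul]

/-- The hypothesis is the defining Ore relation with y in place of Y; this is all that
multiplicativity needs. -/
theorem substFun_Y_mul {y : OreExtension δ} (hy : ∀ a, y * C δ a = C δ a * y + C δ (δ a))
    (P : OreExtension δ) : substFun δ y (Y δ * P) = y * substFun δ y P := by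
  refine induction_monomial δ (p := fun P => substFun δ y (Y δ * P) = y * substFun δ y P) ?_ ?_ P
  · intro P Q hP hQ
    rw [mul_add, substFun_add, substFun_add, hP, hQ, mul_add]
  · intro j a
    rw [Y_mul_monomial, substFun_add, substFun_monomial, substFun_monomial, substFun_monomial,
      ← mul_assoc, hy, add_mul, pow_succ', mul_assoc]

theorem monomial_eq (j : ℕ) (a : A) :
    (toPoly δ).symm (Polynomial.monomial j a) = C δ a * Y δ ^ j := by
  have hY : Y δ ^ j = (toPoly δ).symm (Polynomial.monomial j 1) := by
    induction j with
    | zero => rw [pow_zero, Polynomial.monomial_zero_left, Polynomial.C_1]; rfl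
    | succ j ih => rw [pow_succ', ih, Y_mul_monomial]; simp
  rw [hY, C_mul_eq, LinearEquiv.apply_symm_apply, Polynomial.C_mul_monomial, mul_one]

theorem substFun_mul {y : OreExtension δ} (hy : ∀ a, y * C δ a = C δ a * y + C δ (δ a))
    (P Q : OreExtension δ) : substFun δ y (P * Q) = substFun δ y P * substFun δ y Q := by
  refine induction_monomial δ
    (p := fun P => substFun δ y (P * Q) = substFun δ y P * substFun δ y Q) ?_ ?_ P
  · intro P P' hP hP'
    rw [add_mul, substFun_add, substFun_add, hP, hP', add_mul]
  · intro j a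
    rw [substFun_monomial, monomial_eq, mul_assoc, substFun_C_mul, mul_assoc]
    congr 1
    induction j with
    | zero => simp
    | succ j ih => rw [pow_succ', pow_succ', mul_assoc, substFun_Y_mul δ hy, ih, mul_assoc]

theorem substFun_one (y : OreExtension δ) : substFun δ y 1 = 1 := by
  have h := substFun_monomial δ y 0 1
  rw [pow_zero, mul_one] at h
  exact h

/-- The endomorphism `Y ↦ y` of the Ore extension. -/
def subst {y : OreExtension δ} (hy : ∀ a, y * C δ a = C δ a * y + C δ (δ a)) :
    OreExtension δ →+* OreExtension δ where
  toFun := substFun δ y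
  map_one' := substFun_one δ y
  map_mul' := substFun_mul δ hy
  map_zero' := substFun_zero δ y
  map_add' := substFun_add δ y

theorem Y_add_C_mul_C (h a : A) :
    (Y δ + C δ h) * C δ a = C δ a * (Y δ + C δ h) + C δ (δ a) := by
  rw [add_mul, mul_add, Y_mul_C, C_mul_C, C_mul_C, mul_comm h]
  abel

/-- The endomorphism `Y ↦ Y + h` of the Ore extension. -/
def shift (h : A) : OreExtension δ →+* OreExtension δ := subst δ (Y_add_C_mul_C δ h)

theorem shift_monomial (h : A) (j : ℕ) (a : A) :
    shift δ h ((toPoly δ).symm (Polynomial.monomial j a)) = C δ a * (Y δ + C δ h) ^ j :=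
  substFun_monomial δ _ j a

end OreExtension

namespace WeylFrac

open Polynomial LFrac

variable {K : Type*} [Field K] {l : ℕ}

theorem sym_mul (hl : 0 < l) {τ c c' : ℚ} (hτ : -1 < τ) {P Q : WeylFrac K l}
    (hP : Psi K l P ∈ fil l τ c) (hQ : Psi K l Q ∈ fil l τ c') :
    sym l τ (c + c') (Psi K l (P * Q)) = sym l τ c (Psi K l P) * sym l τ c' (Psi K l Q) :=
  sym_leftMul hl hτ hP hQ

theorem sym_one (τ : ℚ) : sym l τ 0 (Psi K l 1) = 1 := by
  rw [Psi_one, sym_mon, if_pos (by simp [wt]), monomial_zero_left, C_1]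

theorem sym_pow (hl : 0 < l) {τ c : ℚ} (hτ : -1 < τ) {P : WeylFrac K l}
    (hP : Psi K l P ∈ fil l τ c) (k : ℕ) :
    sym l τ (k * c) (Psi K l (P ^ k)) = sym l τ c (Psi K l P) ^ k := by
  induction k with
  | zero => simpa using sym_one τ
  | succ k ih =>
    rw [pow_succ, pow_succ, show ((k + 1 : ℕ) : ℚ) * c = k * c + c by push_cast; ring,
      sym_mul hl hτ (pow_mem_fil hl hτ.le hP k) hP, ih]

/-- The endomorphism `Y ↦ Y + α X ^ (i / l)`. -/
def shift (l : ℕ) (i : ℤ) (α : K) : WeylFrac K l →+* WeylFrac K l :=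
  OreExtension.shift (fracDeriv K l) (AddMonoidAlgebra.single i α)

/-- X^τ, which exists because l τ is an integer, has the same weight τ as Y. The shift therefore
preserves the filtration and acts on leading polynomials by z ↦ z + α. -/
theorem shift_mem_fil_and_sym (hl : 0 < l) {τ c : ℚ} (hτ : -1 < τ) {i : ℤ} (hi : l * τ = i) (α : K)
    {P : WeylFrac K l} (hP : Psi K l P ∈ fil l τ c) :
    Psi K l (shift l i α P) ∈ fil l τ c ∧
      sym l τ c (Psi K l (shift l i α P)) = (sym l τ c (Psi K l P)).comp (X + C α) := by
  have hl' : (l : ℚ) ≠ 0 := by exact_mod_cast hl.ne'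
  have hY : Psi K l (OreExtension.Y _ + OreExtension.C _ (AddMonoidAlgebra.single i α)) =
      mon 0 1 1 + mon i 0 α := rfl
  have hw1 : wt l τ 0 1 = τ := by simp [wt]
  have hw2 : wt l τ i 0 = τ := by
    simp only [wt, ← hi]; field_simp; simp
  have hYfil : Psi K l (OreExtension.Y _ + OreExtension.C _ (AddMonoidAlgebra.single i α)) ∈
      fil l τ τ := by
    rw [hY]
    exact add_mem (mon_mem_fil _ hw1.le) (mon_mem_fil _ hw2.le)
  have hYsym : sym l τ τ (Psi K l (OreExtension.Y _ +
      OreExtension.C _ (AddMonoidAlgebra.single i α))) = X + C α := by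
    rw [hY, map_add, sym_mon, sym_mon, if_pos hw1, if_pos hw2, monomial_one_one_eq_X,
      monomial_zero_left]
  have key := fil_induction (l := l) (τ := τ) (c := c) (p := fun R : LFrac K =>
    Psi K l (shift l i α ((Psi K l).symm R)) ∈ fil l τ c ∧
      sym l τ c (Psi K l (shift l i α ((Psi K l).symm R))) = (sym l τ c R).comp (X + C α))
      ?_ ?_ ?_ hP
  · simpa using key
  · simp
  · rintro R R' ⟨h1, h2⟩ ⟨h3, h4⟩
    refine ⟨?_, ?_⟩
    · simp only [map_add]; exact add_mem h1 h3
    · simp only [map_add, h2, h4, add_comp]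
  · intro i' j a hw
    have e1 : shift l i α ((Psi K l).symm (mon i' j a)) =
        OreExtension.C _ (AddMonoidAlgebra.single i' a) * (OreExtension.Y _ +
          OreExtension.C _ (AddMonoidAlgebra.single i α)) ^ j :=
      OreExtension.shift_monomial _ _ _ _
    have e2 : Psi K l (OreExtension.C _ (AddMonoidAlgebra.single i' a)) = mon i' 0 a := rfl
    have hc : Psi K l (OreExtension.C _ (AddMonoidAlgebra.single i' a)) ∈
        fil l τ (wt l τ i' 0) := by
      rw [e2]; exact mon_mem_fil _ le_rfl
    have hwt : wt l τ i' j = wt l τ i' 0 + j * τ := by simp only [wt]; push_cast; ring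
    have hmem := mul_mem_fil hl hτ.le hc (pow_mem_fil hl hτ.le hYfil j)
    have hsym := sym_mul hl hτ hc (pow_mem_fil hl hτ.le hYfil j)
    rw [← e1, ← hwt] at hmem hsym
    refine ⟨fil_mono hw hmem, ?_⟩
    rw [sym_mon]
    split_ifs with hcw
    · rw [← hcw, hsym, sym_pow hl hτ hYfil, hYsym, e2, sym_mon, if_pos rfl]
      rw [← C_mul_X_pow_eq_monomial, ← C_mul_X_pow_eq_monomial]
      simp
    · rw [zero_comp]
      exact sym_eq_zero_of_mem_fil hmem (lt_of_le_of_ne hw hcw)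

end WeylFrac

end

/-! ### Corners, vertices and turning the direction. -/

noncomputable section

namespace WeylFrac

open Polynomial LFrac

variable {K : Type*} [Field K] {l : ℕ}

/-- `(i / l, j)` is the highest point of the face of `P` in the direction `(1, τ)`. -/
def IsCorner (τ : ℚ) (i : ℤ) (j : ℕ) (P : WeylFrac K l) : Prop :=
  Psi K l P ∈ fil l τ (wt l τ i j) ∧ (sym l τ (wt l τ i j) (Psi K l P)).natDegree = j

/-- `(i / l, j)` is the only point of the face of `P` in the direction `(1, τ)`. -/
def IsVertex (τ : ℚ) (i : ℤ) (j : ℕ) (P : WeylFrac K l) : Prop :=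
  Psi K l P ∈ fil l τ (wt l τ i j) ∧ ∃ c ≠ 0, sym l τ (wt l τ i j) (Psi K l P) = C c * X ^ j

theorem IsVertex.coeff_ne_zero (hl : 0 < l) {τ : ℚ} {i : ℤ} {j : ℕ} {P : WeylFrac K l}
    (h : IsVertex τ i j P) : ((Psi K l P).coeff j).coeff i ≠ 0 := by
  obtain ⟨_, c, hc, hs⟩ := h
  rw [← sym_coeff hl τ, hs]
  simpa using hc

theorem IsVertex.lt (hl : 0 < l) {τ : ℚ} {i i' : ℤ} {j j' : ℕ} {P : WeylFrac K l}
    (h : IsVertex τ i j P) (hne : ((Psi K l P).coeff j').coeff i' ≠ 0) (hj : j' ≠ j) :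
    wt l τ i' j' < wt l τ i j := by
  obtain ⟨hf, c, _, hs⟩ := h
  refine lt_of_le_of_ne (hf i' j' hne) fun he => hne ?_
  rw [← sym_coeff hl τ, he, hs, coeff_C_mul, coeff_X_pow, if_neg hj, mul_zero]

/-- The slopes of the segments from `(i / l, j)` to the lower points of the support of `P`. -/
def slopes (i : ℤ) (j : ℕ) (P : WeylFrac K l) : Finset ℚ :=
  ((expSupport (Psi K l P)).filter fun e => e.2 < j).image
    fun e => ((e.1 - i : ℤ) : ℚ) / l / ((j : ℚ) - e.2)

theorem mem_expSupport {P : LFrac K} {i : ℤ} {j : ℕ} :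
    (i, j) ∈ expSupport P ↔ (P.coeff j).coeff i ≠ 0 := by
  simp only [expSupport, Finset.mem_biUnion, Finset.mem_image, Finsupp.mem_support_iff,
    Prod.mk.injEq, Polynomial.mem_support_iff]
  constructor
  · rintro ⟨j, _, i, hi, rfl, rfl⟩; exact hi
  · intro h
    exact ⟨j, fun h0 => h (by simp [h0]), i, h, rfl, rfl⟩

theorem slope_le_iff (τ : ℚ) (i i' : ℤ) {j j' : ℕ} (hj : j' < j) :
    ((i' - i : ℤ) : ℚ) / l / ((j : ℚ) - j') ≤ τ ↔ wt l τ i' j' ≤ wt l τ i j := by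
  have : (0 : ℚ) < (j : ℚ) - j' := by
    have : (j' : ℚ) < j := by exact_mod_cast hj
    linarith
  rw [div_le_iff₀ this]
  simp only [wt]
  push_cast
  rw [sub_div]
  constructor <;> intro h <;> linarith

theorem slope_eq_iff (τ : ℚ) (i i' : ℤ) {j j' : ℕ} (hj : j' < j) :
    ((i' - i : ℤ) : ℚ) / l / ((j : ℚ) - j') = τ ↔ wt l τ i' j' = wt l τ i j := by
  have : (0 : ℚ) < (j : ℚ) - j' := by
    have : (j' : ℚ) < j := by exact_mod_cast hj
    linarith
  rw [div_eq_iff this.ne']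
  simp only [wt]
  push_cast
  rw [sub_div]
  constructor <;> intro h <;> linarith

theorem IsVertex.slope_lt (hl : 0 < l) {τ s : ℚ} {i : ℤ} {j : ℕ} {P : WeylFrac K l}
    (h : IsVertex τ i j P) (hs : s ∈ slopes i j P) : s < τ := by
  simp only [slopes, Finset.mem_image, Finset.mem_filter] at hs
  obtain ⟨⟨i', j'⟩, ⟨he, hj⟩, rfl⟩ := hs
  have hlt := h.lt hl (mem_expSupport.1 he) (ne_of_lt hj)
  refine lt_of_le_of_ne ((slope_le_iff τ i i' hj).2 hlt.le) fun h0 => ?_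
  exact hlt.ne ((slope_eq_iff τ i i' hj).1 h0)

/-- Decreasing τ makes points above the vertex lose even more weight than the vertex does, so only
lower points can catch up, and the slopes record when they do. -/
theorem IsVertex.isCorner (hl : 0 < l) {τ τ' : ℚ} {i : ℤ} {j : ℕ} {P : WeylFrac K l}
    (h : IsVertex τ i j P) (hlt : τ' < τ) (hs : ∀ s ∈ slopes i j P, s ≤ τ') :
    IsCorner τ' i j P := by
  have habove : ∀ i' j', ((Psi K l P).coeff j').coeff i' ≠ 0 → j < j' →
      wt l τ' i' j' < wt l τ' i j := by
    intro i' j' hne hj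
    have h1 := h.lt hl hne (ne_of_gt hj)
    have h2 : (j : ℚ) < j' := by exact_mod_cast hj
    simp only [wt] at h1 ⊢
    nlinarith
  refine ⟨fun i' j' hne => ?_, ?_⟩
  · rcases lt_trichotomy j' j with hj | rfl | hj
    · refine (slope_le_iff τ' i i' hj).1 (hs _ ?_)
      exact Finset.mem_image.2 ⟨(i', j'), Finset.mem_filter.2 ⟨mem_expSupport.2 hne, hj⟩, rfl⟩
    · have h1 := h.1 i' j' hne
      simp only [wt] at h1 ⊢
      linarith
    · exact (habove i' j' hne hj).le
  · refine le_antisymm (natDegree_le_iff_coeff_eq_zero.2 fun j' hj => ?_)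
      (le_natDegree_of_ne_zero (by rw [sym_coeff hl]; exact h.coeff_ne_zero hl))
    by_contra hne
    obtain ⟨i', hi'⟩ := exists_of_sym_coeff_ne_zero hne
    rw [← hi', sym_coeff hl] at hne
    exact (habove i' j' hne hj).ne hi'

theorem not_isVertex_of_mem_slopes (hl : 0 < l) {τ : ℚ} {i : ℤ} {j : ℕ} {P : WeylFrac K l}
    (hs : τ ∈ slopes i j P) : ¬ IsVertex τ i j P :=
  fun h => (h.slope_lt hl hs).false

/-- Turning the direction `(1, τ)` towards `(1, -1)` until a new face appears. -/
theorem exists_next_corner (hl : 0 < l) {τ : ℚ} (hτ : -1 < τ) {i i' : ℤ} {j j' : ℕ}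
    {P Q : WeylFrac K l} (hP : IsVertex τ i j P) (hQ : IsVertex τ i' j' Q) :
    ∃ τ', -1 ≤ τ' ∧ τ' < τ ∧ IsCorner τ' i j P ∧ IsCorner τ' i' j' Q ∧
      (τ' = -1 ∨ ¬ (IsVertex τ' i j P ∧ IsVertex τ' i' j' Q)) := by
  classical
  -- The new direction is the largest slope of either element; -1 is inserted as the bound at which
  -- turning stops.
  set S : Finset ℚ := insert (-1) (slopes i j P ∪ slopes i' j' Q) with hS
  have hne : S.Nonempty := ⟨-1, Finset.mem_insert_self _ _⟩
  have hmax : ∀ s ∈ S, s ≤ S.max' hne := fun s hs => S.le_max' s hs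
  have hmem := S.max'_mem hne
  have hlt : S.max' hne < τ := by
    rcases Finset.mem_insert.1 hmem with h | h
    · rw [h]; exact hτ
    · rcases Finset.mem_union.1 h with h | h
      · exact hP.slope_lt hl h
      · exact hQ.slope_lt hl h
  refine ⟨S.max' hne, hmax _ (Finset.mem_insert_self _ _), hlt, hP.isCorner hl hlt ?_,
    hQ.isCorner hl hlt ?_, ?_⟩
  · intro s hs
    exact hmax s (Finset.mem_insert_of_mem (Finset.mem_union_left _ hs))
  · intro s hs
    exact hmax s (Finset.mem_insert_of_mem (Finset.mem_union_right _ hs))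
  · rcases Finset.mem_insert.1 hmem with h | h
    · exact Or.inl h
    · right
      rintro ⟨h1, h2⟩
      rcases Finset.mem_union.1 h with h | h
      · exact not_isVertex_of_mem_slopes hl h h1
      · exact not_isVertex_of_mem_slopes hl h h2

theorem zero_le_of_one_mem_fil {τ c : ℚ} (h : Psi K l 1 ∈ fil l τ c) : 0 ≤ c := by
  have := h 0 0 (by rw [Psi_one, coeff_mon]; simp)
  simpa [wt] using this

/-- The point is e (r - 1/l, r), so both corners have weights proportional to w = (1 + τ) r - 1/l.
-/
theorem wt_mul (hl : 0 < l) (τ : ℚ) (e r : ℕ) :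
    wt l τ (e * (l * r - 1 : ℤ)) (e * r) = e * ((1 + τ) * r - 1 / l) := by
  have hl' : (l : ℚ) ≠ 0 := by exact_mod_cast hl.ne'
  simp only [wt]
  push_cast
  field_simp
  ring

/-- In the direction `(1, -1)` the bracket of two elements of negative weight is not `1`. -/
theorem false_of_isCorner_neg_one (hl : 0 < l) {m n r : ℕ} (hm : 0 < m) {P Q : WeylFrac K l}
    (h : Q * P - P * Q = 1) (hP : IsCorner (-1) (m * (l * r - 1 : ℤ)) (m * r) P)
    (hQ : IsCorner (-1) (n * (l * r - 1 : ℤ)) (n * r) Q) : False := by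
  have h1 := bracket_mem_fil hl le_rfl hQ.1 hP.1
  rw [h] at h1
  have h2 := zero_le_of_one_mem_fil h1
  rw [wt_mul hl, wt_mul hl] at h2
  have hl' : (0 : ℚ) < 1 / l := by positivity
  have hm' : (0 : ℚ) < m := by exact_mod_cast hm
  have hn' : (0 : ℚ) ≤ n := by positivity
  nlinarith [mul_pos hm' hl', mul_nonneg hn' hl'.le]

/-- If the leading forms have a nonzero constant bracket, the lattice of exponents leaves no room
for a second monomial. -/
theorem sym_eq_monomial_of_wt_eq (hl : 0 < l) {τ : ℚ} {e s r : ℕ} (hs : 1 < s * r)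
    (hτ : ((e + s : ℕ) : ℚ) * ((1 + τ) * r - 1 / l) = 1 + τ) {P : WeylFrac K l}
    (hP : IsCorner τ (e * (l * r - 1 : ℤ)) (e * r) P) :
    sym l τ (wt l τ (e * (l * r - 1 : ℤ)) (e * r)) (Psi K l P) =
      C (sym l τ (wt l τ (e * (l * r - 1 : ℤ)) (e * r)) (Psi K l P)).leadingCoeff
        * X ^ (e * r) := by
  have hl' : (l : ℚ) ≠ 0 := by exact_mod_cast hl.ne'
  set p := sym l τ (wt l τ (e * (l * r - 1 : ℤ)) (e * r)) (Psi K l P) with hp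
  have hdeg : p.natDegree = e * r := hP.2
  ext j
  rw [coeff_C_mul, coeff_X_pow]
  rcases lt_trichotomy j (e * r) with hj | hj | hj
  · rw [if_neg hj.ne, mul_zero]
    by_contra hne
    obtain ⟨z, hz⟩ := exists_int_of_sym_coeff_ne_zero hl hne
    rw [wt_mul hl] at hz
    obtain ⟨t, ht⟩ := Nat.exists_eq_add_of_lt hj
    have hq : (e : ℚ) * r = j + t + 1 := by exact_mod_cast ht
    set N := e + s with hN
    -- `l (1 + τ) (t + 1)` is an integer `v`, and `v (N r - 1) = N (t + 1)`
    have hv : ∃ v : ℤ, (l : ℚ) * (1 + τ) * (t + 1) = v := by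
      refine ⟨z - e * (l * r - 1) + l * (t + 1), ?_⟩
      push_cast
      rw [← hz]
      have hj' : (j : ℚ) = e * r - t - 1 := by linarith
      rw [hj']
      field_simp
      ring
    obtain ⟨v, hv⟩ := hv
    have hrel : (l : ℚ) * (1 + τ) * (N * r - 1) = N := by
      have h1 : (N : ℚ) * ((1 + τ) * r) * l - N = (1 + τ) * l := by
        have := congrArg (· * (l : ℚ)) hτ
        field_simp at this
        linarith
      linarith
    have hvQ : (v : ℚ) * (N * r - 1) = N * (t + 1) := by
      rw [← hv]
      linear_combination ((t : ℚ) + 1) * hrel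
    have hvZ : v * (N * r - 1 : ℤ) = N * (t + 1) := by exact_mod_cast hvQ
    have hcop : IsCoprime (N * r - 1 : ℤ) (N : ℤ) := ⟨-1, r, by ring⟩
    have hdvd : (N * r - 1 : ℤ) ∣ t + 1 :=
      hcop.dvd_of_dvd_mul_left ⟨v, by rw [← hvZ]; ring⟩
    -- This gives N r - 1 ≤ t + 1 ≤ e r, whereas N r - 1 = e r + (s r - 1) exceeds e r.
    have hle := Int.le_of_dvd (by positivity) hdvd
    have h2 : (t + 1 : ℤ) ≤ e * r := by
      have : t + 1 ≤ e * r := by omega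
      exact_mod_cast this
    have h3 : (1 : ℤ) < s * r := by exact_mod_cast hs
    rw [hN] at hle
    push_cast at hle
    nlinarith
  · rw [if_pos hj, mul_one, leadingCoeff, hdeg, hj]
  · rw [if_neg hj.ne', mul_zero]
    exact coeff_eq_zero_of_natDegree_lt (by rw [hdeg]; exact hj)

end WeylFrac

end

/-! ### The single common root and the descent in τ. -/

noncomputable section

namespace WeylFrac

open Polynomial LFrac

variable {K : Type*} [Field K] {l : ℕ}

/-- The bracket 1 has weight 0, so it is seen in weight a + b - (1 + τ) only when that is 0. -/
theorem sym_bracket_one [CharZero K] (hl : 0 < l) {τ a b : ℚ} (hτ : -1 < τ) {P Q : WeylFrac K l}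
    (h : Q * P - P * Q = 1) (hP : Psi K l P ∈ fil l τ a) (hQ : Psi K l Q ∈ fil l τ b) :
    1 + τ ≤ a + b ∧ brk (a : K) b (sym l τ b (Psi K l Q)) (sym l τ a (Psi K l P)) =
      if a + b = 1 + τ then 1 else 0 := by
  have h1 := bracket_mem_fil hl hτ.le hQ hP
  rw [h] at h1
  refine ⟨by linarith [zero_le_of_one_mem_fil h1], ?_⟩
  rw [← sym_bracket hl hτ hQ hP, h, Psi_one, sym_mon]
  have hw : wt l τ 0 0 = 0 := by simp [wt]
  rw [hw]
  split_ifs with h2 h3 h3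
  · simp
  · exact absurd (by linarith) h3
  · exact absurd (by linarith) h2
  · rfl

/-- The Wronskian could be nonzero only if (m + n) w = 1 + τ. In that case the lattice leaves both
forms a single monomial, and monomials at proportional points have zero Wronskian. -/
theorem brk_eq_zero_of_isCorner [CharZero K] (hl : 0 < l) {τ : ℚ} (hτ : -1 < τ) {m n r : ℕ}
    (hm : 1 < m) (hn : 1 < n) (hr : 0 < r) {P Q : WeylFrac K l} (h : Q * P - P * Q = 1)
    (hP : IsCorner τ (m * (l * r - 1 : ℤ)) (m * r) P)
    (hQ : IsCorner τ (n * (l * r - 1 : ℤ)) (n * r) Q) :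
    brk ((m * ((1 + τ) * r - 1 / l) : ℚ) : K) (n * ((1 + τ) * r - 1 / l) : ℚ)
      (sym l τ (n * ((1 + τ) * r - 1 / l)) (Psi K l Q))
      (sym l τ (m * ((1 + τ) * r - 1 / l)) (Psi K l P)) = 0 := by
  have hsP := fun hh hw => sym_eq_monomial_of_wt_eq (e := m) (s := n) hl hh hw hP
  have hsQ := fun hh hw => sym_eq_monomial_of_wt_eq (e := n) (s := m) hl hh hw hQ
  have hPf := hP.1
  have hQf := hQ.1
  rw [wt_mul hl] at hPf hQf
  simp only [wt_mul hl] at hsP hsQ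
  obtain ⟨_, hb⟩ := sym_bracket_one hl hτ h hPf hQf
  by_cases hc : m * ((1 + τ) * r - 1 / l) + n * ((1 + τ) * r - 1 / l) = 1 + τ
  · rw [hsP (by nlinarith) (by push_cast; linarith), hsQ (by nlinarith) (by push_cast; linarith)]
    refine brk_pow_eq_zero ?_ _ _ _
    push_cast
    ring
  · rw [hb, if_neg hc]

theorem wt_pos_of_isCorner [CharZero K] (hl : 0 < l) {τ : ℚ} (hτ : -1 < τ) {m n r : ℕ}
    {P Q : WeylFrac K l} (h : Q * P - P * Q = 1)
    (hP : IsCorner τ (m * (l * r - 1 : ℤ)) (m * r) P)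
    (hQ : IsCorner τ (n * (l * r - 1 : ℤ)) (n * r) Q) : 0 < (1 + τ) * r - 1 / (l : ℚ) := by
  have hPf := hP.1
  have hQf := hQ.1
  rw [wt_mul hl] at hPf hQf
  obtain ⟨h1, _⟩ := sym_bracket_one hl hτ h hPf hQf
  by_contra! hw
  have h2 : ((m : ℚ) + n) * ((1 + τ) * r - 1 / (l : ℚ)) ≤ 0 :=
    mul_nonpos_of_nonneg_of_nonpos (by positivity) hw
  linarith

theorem exists_sym_eq_pow [IsAlgClosed K] [CharZero K] (hl : 0 < l) {τ : ℚ} (hτ : -1 < τ)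
    {m n r : ℕ} (hm : 1 < m) (hn : 1 < n) (hmn : Nat.Coprime n m) (hr : 0 < r)
    {P Q : WeylFrac K l} (h : Q * P - P * Q = 1)
    (hP : IsCorner τ (m * (l * r - 1 : ℤ)) (m * r) P)
    (hQ : IsCorner τ (n * (l * r - 1 : ℤ)) (n * r) Q) :
    ∃ c ≠ 0, ∃ d ≠ 0, ∃ α : K,
      sym l τ (wt l τ (m * (l * r - 1 : ℤ)) (m * r)) (Psi K l P) = C c * (X - C α) ^ (m * r) ∧
      sym l τ (wt l τ (n * (l * r - 1 : ℤ)) (n * r)) (Psi K l Q) = C d * (X - C α) ^ (n * r) := by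
  have hl' : (l : ℚ) ≠ 0 := by exact_mod_cast hl.ne'
  have hw := wt_pos_of_isCorner hl hτ h hP hQ
  have hb := brk_eq_zero_of_isCorner hl hτ hm hn hr h hP hQ
  obtain ⟨hPf, hPd⟩ := hP
  obtain ⟨hQf, hQd⟩ := hQ
  rw [wt_mul hl] at hPf hQf hPd hQd ⊢
  rw [wt_mul hl]
  set w := (1 + τ) * r - 1 / (l : ℚ) with hwdef
  have hm' : (0 : ℚ) < m := by exact_mod_cast (by omega : 0 < m)
  have hn' : (0 : ℚ) < n := by exact_mod_cast (by omega : 0 < n)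
  set p := sym l τ (m * w) (Psi K l P) with hp
  set q := sym l τ (n * w) (Psi K l Q) with hq
  have hp0 : p ≠ 0 := by
    intro h0
    rw [h0, natDegree_zero] at hPd
    have := Nat.mul_pos (by omega : 0 < m) hr
    omega
  have hq0 : q ≠ 0 := by
    intro h0
    rw [h0, natDegree_zero] at hQd
    have := Nat.mul_pos (by omega : 0 < n) hr
    omega
  have hmult : ∀ α, m * q.rootMultiplicity α = n * p.rootMultiplicity α := by
    intro α
    have h1 := rootMultiplicity_eq_of_brk_eq_zero hq0 hp0 hb α
    have h2 : m * w * (q.rootMultiplicity α : ℚ) = n * w * p.rootMultiplicity α := by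
      exact_mod_cast h1
    have h3 : (m : ℚ) * q.rootMultiplicity α = n * p.rootMultiplicity α := by
      apply mul_left_cancel₀ hw.ne'
      linarith
    exact_mod_cast h3
  have hroot : ∀ α, m ∣ p.rootMultiplicity α := fun α =>
    hmn.symm.dvd_of_dvd_mul_left ⟨_, (hmult α).symm⟩
  obtain ⟨f, hf, z, hz⟩ := exists_normalizer hl hτ h hPf hQf (mul_pos hm' hw)
    (mul_pos hn' hw).le (by rw [hPd]; exact Nat.mul_pos (by omega) hr)
  obtain ⟨α, hα⟩ := exists_eq_C_mul_X_sub_C_pow (by linarith) (by omega) hp0 hf hroot hPd hr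
    (by
      intro hc
      rw [hPd] at hc
      push_cast at hc
      have hc' : w * f.natDegree = (1 + τ) * r := by
        apply mul_left_cancel₀ hm'.ne'
        linarith
      -- Multiplying the degree balance by l and using the summand 1/l of w isolates deg f;
      -- integrality of z then makes r divide deg f, so g^μ can match the top degree of f.
      have hdQ : (f.natDegree : ℚ) = r * (l * f.natDegree - z) := by
        rw [← hz]
        have h1 := congrArg (fun x => (l : ℚ) * x) hc'
        simp only [hwdef] at h1
        have h2 : (l : ℚ) * (((1 + τ) * r - 1 / l) * f.natDegree) =
            l * (1 + τ) * r * f.natDegree - f.natDegree := by field_simp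
        rw [h2] at h1
        linear_combination -h1
      have hdZ : (f.natDegree : ℤ) = r * (l * f.natDegree - z) := by exact_mod_cast hdQ
      have hdvd : r ∣ f.natDegree := by
        rw [← Int.natCast_dvd_natCast]
        exact ⟨_, hdZ⟩
      obtain ⟨μ, hμ⟩ := hdvd
      refine ⟨μ, by rw [hμ, mul_comm], ?_⟩
      rw [hμ] at hc'
      push_cast at hc'
      have hr' : (r : ℚ) ≠ 0 := by exact_mod_cast hr.ne'
      have h3 : w * μ = 1 + τ := by
        apply mul_right_cancel₀ hr'
        linarith
      rw [← h3]
      ring)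
  have hq' : q = C q.leadingCoeff * (X - C α) ^ q.natDegree := by
    refine eq_C_mul_X_sub_C_pow fun β hβ => ?_
    have h1 : p.rootMultiplicity β = 0 := by
      refine rootMultiplicity_eq_zero ?_
      rw [hα, IsRoot, eval_mul, eval_C, eval_pow, eval_sub, eval_X, eval_C]
      exact mul_ne_zero (leadingCoeff_ne_zero.2 hp0) (pow_ne_zero _ (sub_ne_zero.2 hβ))
    have h2 := hmult β
    rw [h1, mul_zero] at h2
    exact (Nat.mul_eq_zero.1 h2).resolve_left (by omega)
  rw [hPd] at hα
  rw [hQd] at hq'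
  exact ⟨_, leadingCoeff_ne_zero.2 hp0, _, leadingCoeff_ne_zero.2 hq0, α, hα, hq'⟩

theorem isVertex_shift (hl : 0 < l) {τ : ℚ} (hτ : -1 < τ) {i i0 : ℤ} {j : ℕ} (hi : l * τ = i0)
    {c α : K} (hc : c ≠ 0) {P : WeylFrac K l} (hP : Psi K l P ∈ fil l τ (wt l τ i j))
    (hs : sym l τ (wt l τ i j) (Psi K l P) = C c * (X - C α) ^ j) :
    IsVertex τ i j (shift l i0 α P) := by
  obtain ⟨h1, h2⟩ := shift_mem_fil_and_sym hl hτ hi α hP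
  refine ⟨h1, c, hc, ?_⟩
  rw [h2, hs]
  simp

/-- In characteristic zero the coefficient of z^(j-1) is nonzero. Two terms of the same weight with
consecutive y-exponents have x-exponents differing by τ. -/
theorem exists_int_of_sym_eq [CharZero K] (hl : 0 < l) {τ : ℚ} {i : ℤ} {j : ℕ} (hj : 0 < j) {c α : K}
    (hc : c ≠ 0) (hα : α ≠ 0) {P : WeylFrac K l}
    (hs : sym l τ (wt l τ i j) (Psi K l P) = C c * (X - C α) ^ j) : ∃ z : ℤ, l * τ = z := by
  obtain ⟨k, rfl⟩ := Nat.exists_eq_add_of_le' hj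
  have hne : (sym l τ (wt l τ i (k + 1)) (Psi K l P)).coeff k ≠ 0 := by
    rw [hs, coeff_C_mul, sub_eq_add_neg, ← C_neg, coeff_X_add_C_pow]
    simp only [Nat.zero_add, Nat.succ_eq_add_one, Nat.add_sub_cancel_left, pow_one, Nat.choose_succ_self_right]
    refine mul_ne_zero hc (mul_ne_zero (neg_ne_zero.2 hα) ?_)
    exact_mod_cast Nat.succ_ne_zero k
  obtain ⟨z, hz⟩ := exists_int_of_sym_coeff_ne_zero hl hne
  refine ⟨z - i, ?_⟩
  have hl' : (l : ℚ) ≠ 0 := by exact_mod_cast hl.ne'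
  push_cast
  rw [← hz, wt]
  push_cast
  field_simp
  ring

/-- A common corner becomes a common vertex after an automorphism `Y ↦ Y + α X ^ τ`. -/
theorem exists_isVertex [IsAlgClosed K] [CharZero K] (hl : 0 < l) {τ : ℚ} (hτ : -1 < τ)
    {m n r : ℕ} (hm : 1 < m) (hn : 1 < n) (hmn : Nat.Coprime n m) (hr : 0 < r)
    {P Q : WeylFrac K l} (h : Q * P - P * Q = 1)
    (hP : IsCorner τ (m * (l * r - 1 : ℤ)) (m * r) P)
    (hQ : IsCorner τ (n * (l * r - 1 : ℤ)) (n * r) Q) :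
    (∃ P' Q' : WeylFrac K l, Q' * P' - P' * Q' = 1 ∧
      IsVertex τ (m * (l * r - 1 : ℤ)) (m * r) P' ∧
      IsVertex τ (n * (l * r - 1 : ℤ)) (n * r) Q') ∧
    ((IsVertex τ (m * (l * r - 1 : ℤ)) (m * r) P ∧ IsVertex τ (n * (l * r - 1 : ℤ)) (n * r) Q) ∨
      ∃ z : ℤ, l * τ = z) := by
  obtain ⟨c, hc, d, hd, α, hp, hq⟩ := exists_sym_eq_pow hl hτ hm hn hmn hr h hP hQ
  rcases eq_or_ne α 0 with rfl | hα
  · rw [C_0, sub_zero] at hp hq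
    have hPv : IsVertex τ (m * (l * r - 1 : ℤ)) (m * r) P := ⟨hP.1, c, hc, hp⟩
    have hQv : IsVertex τ (n * (l * r - 1 : ℤ)) (n * r) Q := ⟨hQ.1, d, hd, hq⟩
    exact ⟨⟨P, Q, h, hPv, hQv⟩, Or.inl ⟨hPv, hQv⟩⟩
  · obtain ⟨z, hz⟩ := exists_int_of_sym_eq hl (Nat.mul_pos (by omega) hr) hc hα hp
    refine ⟨⟨shift l z α P, shift l z α Q, ?_, isVertex_shift hl hτ hz hc hP.1 hp,
      isVertex_shift hl hτ hz hd hQ.1 hq⟩, Or.inr ⟨z, hz⟩⟩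
    rw [← map_mul, ← map_mul, ← map_sub, h, map_one]

theorem false_of_isVertex [IsAlgClosed K] [CharZero K] (hl : 0 < l) {m n r : ℕ} (hm : 1 < m)
    (hn : 1 < n) (hmn : Nat.Coprime n m) (hr : 0 < r) (k : ℕ) {τ : ℚ} (hτ : -1 < τ)
    (hk : l * (τ + 1) ≤ k) {P Q : WeylFrac K l} (h : Q * P - P * Q = 1)
    (hP : IsVertex τ (m * (l * r - 1 : ℤ)) (m * r) P)
    (hQ : IsVertex τ (n * (l * r - 1 : ℤ)) (n * r) Q) : False := by
  have hl' : (0 : ℚ) < l := by exact_mod_cast hl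
  induction k generalizing τ P Q with
  | zero =>
    have : (0 : ℚ) < l * (τ + 1) := mul_pos hl' (by linarith)
    rw [Nat.cast_zero] at hk
    linarith
  | succ k ih =>
    obtain ⟨τ', h1, h2, hP', hQ', h3⟩ := exists_next_corner hl hτ hP hQ
    rcases eq_or_lt_of_le h1 with rfl | h1
    · exact false_of_isCorner_neg_one hl (by omega) h hP' hQ'
    · obtain ⟨⟨P1, Q1, hPQ, hPv, hQv⟩, h4⟩ := exists_isVertex hl h1 hm hn hmn hr h hP' hQ'
      -- Some face is new, so the root is not 0 and l τ' is an integer. Being strictly below k + 1,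
      -- the integer l (τ' + 1) is at most k.
      obtain ⟨z, hz⟩ := h4.resolve_left (h3.resolve_left h1.ne')
      refine ih h1 ?_ hPQ hPv hQv
      have h5 : (l : ℚ) * (τ' + 1) < (k + 1 : ℕ) := lt_of_lt_of_le (by nlinarith) hk
      rw [mul_add, hz, mul_one] at h5 ⊢
      have h6 : z + l < ((k + 1 : ℕ) : ℤ) := by exact_mod_cast h5
      have h7 : z + l ≤ (k : ℤ) := by push_cast at h6; omega
      exact_mod_cast h7

theorem false_of_isCorner [IsAlgClosed K] [CharZero K] (hl : 0 < l) {m n r : ℕ} (hm : 1 < m)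
    (hn : 1 < n) (hmn : Nat.Coprime n m) (hr : 0 < r) {τ : ℚ} (hτ : -1 < τ)
    {P Q : WeylFrac K l} (h : Q * P - P * Q = 1)
    (hP : IsCorner τ (m * (l * r - 1 : ℤ)) (m * r) P)
    (hQ : IsCorner τ (n * (l * r - 1 : ℤ)) (n * r) Q) : False := by
  obtain ⟨⟨P1, Q1, hPQ, hPv, hQv⟩, _⟩ := exists_isVertex hl hτ hm hn hmn hr h hP hQ
  obtain ⟨k, hk⟩ := exists_nat_ge ((l : ℚ) * (τ + 1))
  exact false_of_isVertex hl hm hn hmn hr k hτ hk hPQ hPv hQv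

end WeylFrac

end

/-! ### End points and degrees in terms of leading polynomials. -/

noncomputable section

theorem maxOver_eq {α : Type*} {s : Finset α} {f : α → ℚ} {x : α} (hx : x ∈ s)
    (h : ∀ y ∈ s, f y ≤ f x) : maxOver s f = f x := by
  rw [maxOver, dif_pos ⟨x, hx⟩]
  exact le_antisymm (Finset.sup'_le _ _ h) (Finset.le_sup' f hx)

namespace LFrac

open Polynomial

variable {K : Type*} [Field K] {l : ℕ}

theorem mem_supp {P : LFrac K} {x : ℚ × ℚ} :
    x ∈ supp l P ↔ ∃ i j, (P.coeff j).coeff i ≠ 0 ∧ point l (i, j) = x := by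
  simp only [supp, Finset.mem_image, Prod.exists, WeylFrac.mem_expSupport]

theorem vDeg_eq {d : ℤ × ℤ} {P : LFrac K} {i : ℤ} {j : ℕ} (hne : (P.coeff j).coeff i ≠ 0)
    (h : ∀ i' j', (P.coeff j').coeff i' ≠ 0 →
      vPoint d (point l (i', j')) ≤ vPoint d (point l (i, j))) :
    vDeg l d P = vPoint d (point l (i, j)) := by
  refine maxOver_eq (mem_supp.2 ⟨i, j, hne, rfl⟩) fun y hy => ?_
  obtain ⟨i', j', hne', rfl⟩ := mem_supp.1 hy
  exact h i' j' hne'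

theorem coeff_lead (d : ℤ × ℤ) (P : LFrac K) (i : ℤ) (j : ℕ) :
    ((lead l d P).coeff j).coeff i =
      if vPoint d (point l (i, j)) = vDeg l d P then (P.coeff j).coeff i else 0 := by
  have h : lead l d P = ∑ e ∈ (expSupport P).filter
      (fun e => vPoint d (point l e) = vDeg l d P), mon e.1 e.2 ((P.coeff e.2).coeff e.1) := rfl
  rw [h]
  simp only [finsetSum_coeff, AddMonoidAlgebra.coeff_sum, Finsupp.coe_finsetSum,
    Finset.sum_apply, coeff_mon]
  by_cases hne : (P.coeff j).coeff i = 0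
  · rw [hne, ite_self]
    refine Finset.sum_eq_zero fun e _ => ?_
    split_ifs with h
    · rw [h.1, h.2, hne]
    · rfl
  · split_ifs with hv
    · rw [Finset.sum_eq_single (i, j)]
      · simp
      · intro e _ he
        rw [if_neg]
        rintro ⟨h1, h2⟩
        exact he (Prod.ext h2 h1)
      · intro hnot
        exact absurd (Finset.mem_filter.2 ⟨WeylFrac.mem_expSupport.2 hne, hv⟩) hnot
    · refine Finset.sum_eq_zero fun e he => ?_
      rw [if_neg]
      rintro ⟨h1, h2⟩
      apply hv
      have := (Finset.mem_filter.1 he).2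
      rwa [show e = (i, j) from Prod.ext h2 h1] at this

theorem vPoint_point {ρ σ : ℤ} (hρ : 0 < ρ) (i : ℤ) (j : ℕ) :
    vPoint (ρ, σ) (point l (i, j)) = ρ * wt l (σ / ρ) i j := by
  have : (ρ : ℚ) ≠ 0 := by exact_mod_cast hρ.ne'
  simp only [vPoint, point, wt]
  field_simp

theorem vPoint_neg_one_one (i : ℤ) (j : ℕ) :
    vPoint (-1, 1) (point l (i, j)) = j - i / l := by
  simp only [vPoint, point]
  push_cast
  ring

theorem exists_vDeg_eq (hl : 0 < l) {ρ σ : ℤ} (hρ : 0 < ρ) {P : LFrac K} (hP : P ≠ 0) :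
    ∃ c, P ∈ fil l (σ / ρ) c ∧ sym l (σ / ρ) c P ≠ 0 ∧ vDeg l (ρ, σ) P = ρ * c := by
  obtain ⟨c, hf, hs⟩ := exists_sym_ne_zero hl ((σ : ℚ) / ρ) hP
  refine ⟨c, hf, hs, ?_⟩
  have hlc : (sym l (σ / ρ) c P).coeff (sym l (σ / ρ) c P).natDegree ≠ 0 := by
    rwa [coeff_natDegree, Ne, leadingCoeff_eq_zero]
  obtain ⟨i, hi⟩ := exists_of_sym_coeff_ne_zero hlc
  have hρ' : (0 : ℚ) < ρ := by exact_mod_cast hρ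
  rw [vDeg_eq (i := i) (j := (sym l (σ / ρ) c P).natDegree), vPoint_point hρ, hi]
  · rwa [← sym_coeff hl (σ / ρ), hi]
  · intro i' j' hne
    rw [vPoint_point hρ, vPoint_point hρ, hi]
    exact mul_le_mul_of_nonneg_left (hf i' j' hne) hρ'.le

theorem coeff_lead' {ρ σ : ℤ} (hρ : 0 < ρ) {P : LFrac K} {c : ℚ} (hc : vDeg l (ρ, σ) P = ρ * c)
    (i : ℤ) (j : ℕ) : ((lead l (ρ, σ) P).coeff j).coeff i =
      if wt l (σ / ρ) i j = c then (P.coeff j).coeff i else 0 := by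
  have : (ρ : ℚ) ≠ 0 := by exact_mod_cast hρ.ne'
  rw [coeff_lead, vPoint_point hρ, hc]
  simp only [mul_right_inj' this]

theorem le_natDegree_of_coeff_lead_ne_zero (hl : 0 < l) {ρ σ : ℤ} (hρ : 0 < ρ) {P : LFrac K}
    {c : ℚ} (hc : vDeg l (ρ, σ) P = ρ * c) {i : ℤ} {j : ℕ}
    (h : ((lead l (ρ, σ) P).coeff j).coeff i ≠ 0) :
    wt l (σ / ρ) i j = c ∧ j ≤ (sym l (σ / ρ) c P).natDegree := by
  rw [coeff_lead' hρ hc] at h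
  split_ifs at h with hw
  · refine ⟨hw, le_natDegree_of_ne_zero ?_⟩
    rwa [← hw, sym_coeff hl]
  · exact absurd rfl h

/-- On the line i/l + τ j = c one has j - i/l = (1 + τ) j - c, which increases with j. So the (-1,
1)-leading part of the face is its highest monomial, whose height is the degree of the leading
polynomial. -/
theorem wBar_lead (hl : 0 < l) {ρ σ : ℤ} (hρ : 0 < ρ) (hρσ : 0 < ρ + σ) {P : LFrac K} {c : ℚ}
    (hc : vDeg l (ρ, σ) P = ρ * c) (hs : sym l (σ / ρ) c P ≠ 0) :
    ∃ i : ℤ, wt l (σ / ρ) i (sym l (σ / ρ) c P).natDegree = c ∧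
      wBar l (lead l (ρ, σ) P) = ((i : ℚ) / l, ((sym l (σ / ρ) c P).natDegree : ℚ)) := by
  have hlc : (sym l (σ / ρ) c P).coeff (sym l (σ / ρ) c P).natDegree ≠ 0 := by
    rwa [coeff_natDegree, Ne, leadingCoeff_eq_zero]
  obtain ⟨i, hi⟩ := exists_of_sym_coeff_ne_zero hlc
  refine ⟨i, hi, ?_⟩
  have hτ : (0 : ℚ) < 1 + σ / ρ := by
    have h1 : (0 : ℚ) < ρ := by exact_mod_cast hρ
    have h2 : (0 : ℚ) < ρ + σ := by exact_mod_cast hρσ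
    have : (1 : ℚ) + σ / ρ = (ρ + σ) / ρ := by field_simp
    rw [this]
    positivity
  set M := (sym l (σ / ρ) c P).natDegree with hM
  have hcoeff : ((lead l (ρ, σ) P).coeff M).coeff i ≠ 0 := by
    rw [coeff_lead' hρ hc, if_pos hi, ← sym_coeff hl (σ / ρ), hi]
    exact hlc
  have hv : vDeg l (-1, 1) (lead l (ρ, σ) P) = M - i / l := by
    rw [vDeg_eq hcoeff, vPoint_neg_one_one]
    intro i' j' hne
    obtain ⟨hw, hj⟩ := le_natDegree_of_coeff_lead_ne_zero hl hρ hc hne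
    rw [vPoint_neg_one_one, vPoint_neg_one_one]
    have hj' : (j' : ℚ) ≤ M := Nat.cast_le.2 hj
    simp only [wt] at hw hi
    nlinarith
  have hcoeff2 : ((lead l (-1, 1) (lead l (ρ, σ) P)).coeff M).coeff i ≠ 0 := by
    rw [coeff_lead, hv, vPoint_neg_one_one, if_pos rfl]
    exact hcoeff
  have hmax : maxOver (supp l (lead l (-1, 1) (lead l (ρ, σ) P))) Prod.snd = M := by
    rw [maxOver_eq (x := point l (i, M)) (mem_supp.2 ⟨i, M, hcoeff2, rfl⟩)]
    · rfl
    · intro y hy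
      obtain ⟨i', j', hne, rfl⟩ := mem_supp.1 hy
      have hne' : ((lead l (ρ, σ) P).coeff j').coeff i' ≠ 0 := by
        intro h0
        apply hne
        rw [coeff_lead, h0, ite_self]
      have := (le_natDegree_of_coeff_lead_ne_zero hl hρ hc hne').2
      exact Nat.cast_le.2 this
  rw [wBar, hmax, hv, sub_sub_cancel]

theorem natDegree_sym_pos (hl : 0 < l) {ρ σ : ℤ} (hρ : 0 < ρ) {P : LFrac K} {c : ℚ}
    (hc : vDeg l (ρ, σ) P = ρ * c) (hcard : 1 < (supp l (lead l (ρ, σ) P)).card) :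
    0 < (sym l (σ / ρ) c P).natDegree := by
  by_contra! h0
  obtain ⟨x, hx, y, hy, hxy⟩ := Finset.one_lt_card.1 hcard
  obtain ⟨i, j, hne, rfl⟩ := mem_supp.1 hx
  obtain ⟨i', j', hne', rfl⟩ := mem_supp.1 hy
  obtain ⟨hw, hj⟩ := le_natDegree_of_coeff_lead_ne_zero hl hρ hc hne
  obtain ⟨hw', hj'⟩ := le_natDegree_of_coeff_lead_ne_zero hl hρ hc hne'
  obtain rfl : j = 0 := by omega
  obtain rfl : j' = 0 := by omega
  exact hxy (by rw [wt_injective hl (hw.trans hw'.symm)])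

end LFrac

end

/-! ### Reduction of the theorem to a pair of aligned corners. -/

open WeylFrac LFrac in
theorem mainTheorem4 {K : Type*} [Field K] [IsAlgClosed K] [CharZero K]
    (l : ℕ) (hl : 0 < l) (P Q : WeylFrac K l)
    (ρ σ : ℤ) (hdir : (ρ, σ) ∈ Directions) (hσ : σ ≤ 0)
    (ha : Q * P - P * Q = 1)
    (hb : (ρ, σ) ∈ WeylFrac.Dir P ∩ WeylFrac.Dir Q)
    (hc : 0 < WeylFrac.vDeg (ρ, σ) P ∧ 0 < WeylFrac.vDeg (ρ, σ) Q)
    (he : (¬ ∃ k : ℕ, WeylFrac.vDeg (ρ, σ) Q / WeylFrac.vDeg (ρ, σ) P = k) ∧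
      (¬ ∃ k : ℕ, WeylFrac.vDeg (ρ, σ) P / WeylFrac.vDeg (ρ, σ) Q = k))
    (n m : ℕ) (hn : 1 < n) (hm : 1 < m) (hnm : Nat.Coprime n m)
    (hratio : WeylFrac.vDeg (ρ, σ) Q / WeylFrac.vDeg (ρ, σ) P = (n : ℚ) / (m : ℚ))
    (r : ℚ) (hr : 2 ≤ r) :
    (1 / (m : ℚ)) • WeylFrac.en (ρ, σ) P ≠ (r - 1 / (l : ℚ), r) := by
  intro hen
  have hρσ : 0 < ρ + σ := hdir.2
  have hρ : 0 < ρ := by omega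
  have hρ' : (0 : ℚ) < ρ := by exact_mod_cast hρ
  have hl' : (l : ℚ) ≠ 0 := by exact_mod_cast hl.ne'
  have hm' : (0 : ℚ) < m := by exact_mod_cast (by omega : 0 < m)
  have hτ : (-1 : ℚ) < σ / ρ := by
    rw [lt_div_iff₀ hρ']
    have : (0 : ℚ) < ρ + σ := by exact_mod_cast hρσ
    linarith
  have hne : ∀ R : WeylFrac K l, 0 < WeylFrac.vDeg (ρ, σ) R → Psi K l R ≠ 0 := by
    intro R hR h0
    rw [WeylFrac.vDeg, h0] at hR
    simp [LFrac.vDeg, supp, expSupport, maxOver] at hR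
  obtain ⟨a, hPf, hPs, hPv⟩ := exists_vDeg_eq (σ := σ) hl hρ (hne P hc.1)
  obtain ⟨b, hQf, hQs, hQv⟩ := exists_vDeg_eq (σ := σ) hl hρ (hne Q hc.2)
  have hPpos := natDegree_sym_pos hl hρ hPv hb.1.2
  have hQpos := natDegree_sym_pos hl hρ hQv hb.2.2
  obtain ⟨i, hi, hend⟩ := wBar_lead hl hρ hρσ hPv hPs
  have hen' : WeylFrac.en (ρ, σ) P = wBar l (LFrac.lead l (ρ, σ) (Psi K l P)) := rfl
  rw [hen', hend, Prod.smul_mk, Prod.mk.injEq, smul_eq_mul, smul_eq_mul] at hen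
  obtain ⟨hen1, hen2⟩ := hen
  have ha0 : 0 < a := by
    have h1 : 0 < (ρ : ℚ) * a := hPv ▸ hc.1
    exact pos_of_mul_pos_right h1 hρ'.le
  have hab : m * b = n * a := by
    have h1 : (ρ : ℚ) * b / (ρ * a) = n / m := by rw [← hPv, ← hQv]; exact hratio
    rw [mul_div_mul_left _ _ hρ'.ne', div_eq_div_iff ha0.ne' hm'.ne'] at h1
    linarith
  -- the end point of `Q` is aligned with the end point of `P`
  have hdeg : a * (sym l (σ / ρ) b (Psi K l Q)).natDegree =
      b * (sym l (σ / ρ) a (Psi K l P)).natDegree := by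
    obtain ⟨_, hbr⟩ := sym_bracket_one hl hτ ha hPf hQf
    by_contra hcon
    -- Without alignment the Wronskian would have degree one less than the sum of two positive
    -- degrees, hence at least 1, but it is constant.
    have h1 := Polynomial.natDegree_brk hQs hPs (a := (a : K)) (e := b) (by exact_mod_cast hcon)
    have h2 : (if a + b = 1 + σ / ρ then (1 : Polynomial K) else 0).natDegree = 0 := by
      split_ifs <;> simp
    rw [hbr, h2] at h1
    omega
  set M := (sym l (σ / ρ) a (Psi K l P)).natDegree with hM
  set M' := (sym l (σ / ρ) b (Psi K l Q)).natDegree with hM'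
  have hMM : m * M' = n * M := by
    have h1 : (m : ℚ) * M' = n * M := by
      apply mul_left_cancel₀ ha0.ne'
      linear_combination (m : ℚ) * hdeg + (M : ℚ) * hab
    exact_mod_cast h1
  -- Coprimality of m and n makes the rational number r an integer s.
  obtain ⟨s, hs⟩ : m ∣ M := hnm.symm.dvd_of_dvd_mul_left ⟨M', hMM.symm⟩
  have hs' : M' = n * s := by
    apply Nat.eq_of_mul_eq_mul_left (by omega : 0 < m)
    rw [hMM, hs]
    ring
  have hrs : r = s := by
    rw [← hen2, hs]
    push_cast
    field_simp
  have hs0 : 0 < s := by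
    rcases Nat.eq_zero_or_pos s with h0 | h0
    · rw [hs, h0] at hPpos
      omega
    · exact h0
  have hiI : i = m * (l * s - 1 : ℤ) := by
    have h1 : (i : ℚ) = m * (l * s - 1) := by
      rw [hrs] at hen1
      field_simp at hen1
      linarith
    exact_mod_cast h1
  have haw : a = wt l (σ / ρ) (m * (l * s - 1 : ℤ)) (m * s) := by rw [← hi, hiI, hs]
  have hbw : b = wt l (σ / ρ) (n * (l * s - 1 : ℤ)) (n * s) := by
    rw [wt_mul hl] at haw ⊢
    apply mul_left_cancel₀ hm'.ne'
    rw [hab, haw]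
    ring
  exact false_of_isCorner hl hm hn hnm hs0 hτ ha (by rw [WeylFrac.IsCorner, ← haw]; exact ⟨hPf, hs⟩)
    (by rw [WeylFrac.IsCorner, ← hbw]; exact ⟨hQf, hs'⟩)
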